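/- **Setting.** Let $D\ge 1$, let $\mathcal X\subseteq\mathbb R^D$ be compact, let $p_X$ be a probability density on $\mathcal X$ with respect to Lebesgue measure and let $\eta:\mathcal X\to[0,1]$. Draw $n$ independent pairs $(x_1,y_1),\dots,(x_n,y_n)$, where $x_i$ has density $p_X$ and, given $x_i$, $y_i\in\{0,1\}$ equals $1$ with probability $\eta(x_i)$. Write $X=\{x_1,\dots,x_n\}$ and $B(x,r)=\{x'\in\mathcal X:|x-x'|\le r\}$. For $k\ge1$ let $r_k(x)=\inf\{r:|B(x,r)\cap X|\ge k\}$, $N_k(x)=B(x,r_k(x))\cap X$ and $\eta_k(x)=\frac1{|N_k(x)|}\sum_{i=1}^n y_i\,\mathbf 1[x_i\in N_k(x)]$. Let $v_D=\pi^{D/2}/\Gamma(D/2+1)$ be the volume of the unit ball. Let $\omega,r_0,C_\alpha>0$ and $0<\alpha\le1$. **Assumption (A).** (i) For all $x\in\mathcal X$ and $0<r<r_0$, the closed Euclidean ball $\bar B(x,r)\subset\mathbb R^D$ satisfies $\mathrm{Vol}(\mathcal X\cap \bar B(x,r))\ge\omega\,\mathrm{Vol}(\bar B(x,r))$. (ii)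 $p_{X,0}:=\inf_{x\in\mathcal X}p_X(x)>0$. (iii) $|\eta(x)-\eta(x')|\le C_\alpha|x-x'|^\alpha$ for all $x,x'\in\mathcal X$. **Theorem.** 1. Assume (A), let $0<\delta<1$, and let $k\ge 1$ be an integer with $$2^8 D\log^2(4/\delta)\log n\le k\le\tfrac12\,\omega\, p_{X,0}\,v_D\,r_0^D\,n .$$ Then with probability at least $1-\delta$, $$\sup_{x\in\mathcal X}|\eta_k(x)-\eta(x)|\le C_\alpha\Big(\frac{2k}{\omega\, v_D\, n\, p_{X,0}}\Big)^{\alpha/D}+\sqrt{\frac{2\log(4D/\delta)+2D\log n}{k}} .$$ 2. (Rate.) For all $p_0,a,b>0$ there is a constant $A>0$, depending only on $D,\alpha,C_\alpha,\omega,r_0,p_0,a,b$, such that for every $\delta\in(0,1)$ there is an $N$, depending only on $\delta$ and these parameters, with the following property: for all $n\ge N$, all integers $k$ with $a\,n^{2\alpha/(2\alpha+D)}\le k\le b\,n^{2\alpha/(2\alpha+D)}$, and all $(\mathcal X,p_X,\eta)$ satisfying (A) with $p_{X,0}\ge p_0$, with probability at least $1-\delta$, $$\sup_{x\in\mathcal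 X}|\eta_k(x)-\eta(x)|\le A\sqrt{\log n}\;n^{-\alpha/(2\alpha+D)} ,$$ that is, the uniform error is $\widetilde O(n^{-\alpha/(2\alpha+D)})$. 3. (This rate is minimax optimal up to logarithmic factors.) For every compact $\mathcal X\subset\mathbb R^D$ and every probability density $p_X$ on $\mathcal X$ there is a $c>0$ such that for every $n\ge1$ and every estimator $\hat\eta$ (a function of the $n$ labelled data points with $\hat\eta(x)$ measurable for each $x\in\mathcal X$) there is an $\eta:\mathcal X\to[0,1]$ satisfying (iii) for which, with probability at least $1/4$, $|\hat\eta(x)-\eta(x)|\ge c\,n^{-\alpha/(2\alpha+D)}$ for some $x\in\mathcal X$. -/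

import Mathlib

open MeasureTheory

noncomputable section

/-- `p` is a probability density (with respect to Lebesgue measure) on the set `S`; the values
of `p` outside `S` play no role. -/
structure IsDensityOn {D : ℕ} (S : Set (EuclideanSpace ℝ (Fin D)))
    (p : EuclideanSpace ℝ (Fin D) → ℝ) : Prop where
  measurable : Measurable p
  nonneg : ∀ x ∈ S, 0 ≤ p x
  lintegral_eq_one : ∫⁻ x in S, ENNReal.ofReal (p x) = 1

/-- The infimum of the density over the support. -/
def minDensity {D : ℕ} (S : Set (EuclideanSpace ℝ (Fin D)))
    (p : EuclideanSpace ℝ (Fin D) → ℝ) : ℝ :=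
  ⨅ x : S, p x

/-- Support regularity with constants `w` and `r₀`: every Euclidean ball of radius less than `r₀`
centred in `S` has at least the fraction `w` of its volume inside `S`. -/
def SupportRegular {D : ℕ} (S : Set (EuclideanSpace ℝ (Fin D))) (w r₀ : ℝ) : Prop :=
  ∀ x ∈ S, ∀ r : ℝ, 0 < r → r < r₀ →
    ENNReal.ofReal w * volume (Metric.closedBall x r) ≤ volume (S ∩ Metric.closedBall x r)

/-- `η` is a label function `S → [0, 1]` that is `α`-Hölder on `S` with constant `C`. -/
structure IsHolderLabel {D : ℕ} (S : Set (EuclideanSpace ℝ (Fin D)))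
    (η : EuclideanSpace ℝ (Fin D) → ℝ) (α C : ℝ) : Prop where
  mem_Icc : ∀ x ∈ S, η x ∈ Set.Icc (0 : ℝ) 1
  holder : ∀ x ∈ S, ∀ x' ∈ S, |η x - η x'| ≤ C * dist x x' ^ α

/-- The standing assumptions on the support, the density and the label function. -/
structure KNNAssumption {D : ℕ} (S : Set (EuclideanSpace ℝ (Fin D)))
    (p η : EuclideanSpace ℝ (Fin D) → ℝ) (w r₀ α C : ℝ) : Prop where
  compact : IsCompact S
  density : IsDensityOn S p
  regular : SupportRegular S w r₀
  minDensity_pos : 0 < minDensity S p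
  label : IsHolderLabel S η α C

/-- The volume of the unit ball of `ℝ^D`. -/
def unitBallVolume (D : ℕ) : ℝ :=
  Real.pi ^ ((D : ℝ) / 2) / Real.Gamma ((D : ℝ) / 2 + 1)

/-- The distribution of a feature vector: density `p` on `S`. -/
def featureLaw {D : ℕ} (S : Set (EuclideanSpace ℝ (Fin D)))
    (p : EuclideanSpace ℝ (Fin D) → ℝ) : Measure (EuclideanSpace ℝ (Fin D)) :=
  (volume.restrict S).withDensity fun x => ENNReal.ofReal (p x)

/-- The distribution of a labelled data point `(x, y)`: the feature vector `x` has density `p` on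
`S`, and given `x` the label is `y = 1` with probability `η x` and `y = 0` with probability
`1 - η x`. -/
def dataLaw {D : ℕ} (S : Set (EuclideanSpace ℝ (Fin D)))
    (p η : EuclideanSpace ℝ (Fin D) → ℝ) : Measure (EuclideanSpace ℝ (Fin D) × ℝ) :=
  ((featureLaw S p).withDensity fun x => ENNReal.ofReal (η x)).map (fun x => (x, (1 : ℝ))) +
    ((featureLaw S p).withDensity fun x => ENNReal.ofReal (1 - η x)).map (fun x => (x, (0 : ℝ)))

/-- The distribution of `n` independent labelled data points. -/
def sampleLaw {D : ℕ} (S : Set (EuclideanSpace ℝ (Fin D)))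
    (p η : EuclideanSpace ℝ (Fin D) → ℝ) (n : ℕ) :
    Measure (Fin n → EuclideanSpace ℝ (Fin D) × ℝ) :=
  Measure.pi fun _ => dataLaw S p η

/-- The sample points in the ball of radius `r` around `x` (within `S`). -/
def ballPoints {D n : ℕ} (S : Set (EuclideanSpace ℝ (Fin D)))
    (z : Fin n → EuclideanSpace ℝ (Fin D) × ℝ) (x : EuclideanSpace ℝ (Fin D)) (r : ℝ) :
    Set (EuclideanSpace ℝ (Fin D)) :=
  {x' | x' ∈ S ∧ dist x x' ≤ r} ∩ Set.range fun i => (z i).1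

/-- The `k`-NN radius of `x`. -/
def knnRadius {D n : ℕ} (S : Set (EuclideanSpace ℝ (Fin D)))
    (z : Fin n → EuclideanSpace ℝ (Fin D) × ℝ) (k : ℕ) (x : EuclideanSpace ℝ (Fin D)) : ℝ :=
  sInf {r : ℝ | k ≤ (ballPoints S z x r).ncard}

/-- The `k`-NN set of `x`. -/
def knnSet {D n : ℕ} (S : Set (EuclideanSpace ℝ (Fin D)))
    (z : Fin n → EuclideanSpace ℝ (Fin D) × ℝ) (k : ℕ) (x : EuclideanSpace ℝ (Fin D)) :
    Set (EuclideanSpace ℝ (Fin D)) :=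
  ballPoints S z x (knnRadius S z k x)

open Classical in
/-- The `k`-NN label of `x`: the average label over the `k`-NN set of `x`. -/
def knnLabel {D n : ℕ} (S : Set (EuclideanSpace ℝ (Fin D)))
    (z : Fin n → EuclideanSpace ℝ (Fin D) × ℝ) (k : ℕ) (x : EuclideanSpace ℝ (Fin D)) : ℝ :=
  (1 / ((knnSet S z k x).ncard : ℝ)) *
    ∑ i, (z i).2 * (if (z i).1 ∈ knnSet S z k x then 1 else 0)

/-- The event `A` holds with probability at least `q` (it contains a measurable event of
probability at least `q`). -/
def WithProbAtLeast {Ω : Type*} [MeasurableSpace Ω] (μ : Measure Ω) (q : ℝ) (A : Set Ω) : Prop :=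
  ∃ B : Set Ω, MeasurableSet B ∧ B ⊆ A ∧ ENNReal.ofReal q ≤ μ B

end

/-! ### Latent-uniform representation of the sample. -/

section DataLaw

variable {D : ℕ} {S : Set (EuclideanSpace ℝ (Fin D))} {p η η' : EuclideanSpace ℝ (Fin D) → ℝ}

/-! Upper bound. If all `k`-NN neighbours of `x` lie within distance `r`, the error at `x` is at
most a Hölder bias `C * r ^ α` plus the average label noise over the neighbours; both have to be
controlled for all `x` at once.

Noise: neighbour sets are cut out of the sample by balls. The lifting `x ↦ (1, ‖x‖ ^ 2, x)` turns
balls into half-spaces of a space of dimension `D + 2`, so balls shatter at most `D + 2` points, and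
Sauer–Shelah leaves at most `(n + 1) ^ (D + 2)` candidate sets (`card_ballCutFamily_le`). Writing
labels as thresholds of independent uniform variables (`sampleLaw_eq_map`) lets the features be
frozen by Fubini; Hoeffding and a union bound over the candidates then finish
(`sampleLaw_deviationEvent_le`).

Bias: choose `r` so that regularity of the support and the lower bound on the density guarantee mass
`2 * k / n` to balls of radius `r`. Slightly smaller balls around a finite net still have mass `3 *
k / (2 * n)`, so by Chernoff each holds `k` points, and every ball of radius `r` contains one of
them (`exists_centres_of_knn`). With `k` of order `n ^ (2 * α / (2 * α + D))`, the bias `(k / n) ^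
(α / D)` and the noise `k ^ (-1 / 2)` have the same order up to a logarithm.

Lower bound. Le Cam's method with the labels `1 / 2` and `1 / 2` plus a Hölder bump of radius `h`
and height of order `h ^ α` at a point where the feature law has finite density. One observation has
likelihood-ratio second moment `1 + O(h ^ (2 * α + D))`, so for `h` of order `n ^ (-1 / (2 * α +
D))` the second moment for `n` observations stays bounded (`exists_indistinguishable_labels`), while
the labels differ by order `h ^ α` at the centre. -/

theorem isProbabilityMeasure_featureLaw (hp : IsDensityOn S p) :
    IsProbabilityMeasure (featureLaw S p) :=
  ⟨by rw [featureLaw, withDensity_apply _ MeasurableSet.univ, Measure.restrict_univ,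
    hp.lintegral_eq_one]⟩

theorem featureLaw_absolutelyContinuous : featureLaw S p ≪ volume :=
  (withDensity_absolutelyContinuous _ _).trans Measure.restrict_le_self.absolutelyContinuous

theorem ae_mem_featureLaw (hS : MeasurableSet S) : ∀ᵐ x ∂featureLaw S p, x ∈ S :=
  (withDensity_absolutelyContinuous _ _).ae_le (ae_restrict_mem hS)

/-- Features almost surely lie in `S`. This allows a label function known only on `S` to be replaced
by a globally measurable, `[0, 1]`-valued one. -/
theorem dataLaw_congr (hS : MeasurableSet S) (h : ∀ x ∈ S, η x = η' x) :
    dataLaw S p η = dataLaw S p η' := by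
  have h1 : ∀ᵐ x ∂featureLaw S p, η x = η' x := by
    filter_upwards [ae_mem_featureLaw hS] with x hx using h x hx
  unfold dataLaw
  congr 2
  · exact withDensity_congr_ae (h1.mono fun x hx => by simp only [hx])
  · exact withDensity_congr_ae (h1.mono fun x hx => by simp only [hx])

/-- The label produced from the latent uniform variable `u` when the label probability is `a`. -/
noncomputable def thresholdLabel (a : ℝ) (u : unitInterval) : ℝ :=
  if (u : ℝ) ≤ a then 1 else 0

theorem thresholdLabel_mem_Icc (a : ℝ) (u : unitInterval) :
    thresholdLabel a u ∈ Set.Icc (0 : ℝ) 1 := by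
  unfold thresholdLabel; split_ifs <;> simp

theorem volume_unitInterval_coe_le {a : ℝ} (ha : a ∈ Set.Icc (0 : ℝ) 1) :
    volume {u : unitInterval | (u : ℝ) ≤ a} = ENNReal.ofReal a := by
  exact unitInterval.volume_Iic ⟨a, ha⟩

theorem volume_unitInterval_not_coe_le {a : ℝ} (ha : a ∈ Set.Icc (0 : ℝ) 1) :
    volume {u : unitInterval | ¬ (u : ℝ) ≤ a} = ENNReal.ofReal (1 - a) := by
  simp only [not_le]
  exact unitInterval.volume_Ioi ⟨a, ha⟩

theorem measurable_thresholdLabel (hη : Measurable η) :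
    Measurable fun q : EuclideanSpace ℝ (Fin D) × unitInterval => thresholdLabel (η q.1) q.2 := by
  unfold thresholdLabel
  refine Measurable.ite ?_ measurable_const measurable_const
  exact measurableSet_le (by fun_prop) (by fun_prop)

/-- For fixed `x` the uniform variable falls below `η x` with probability `η x`. All label
randomness thereby sits in a coordinate independent of the feature. -/
theorem dataLaw_eq_map (hp : IsDensityOn S p) (hη : Measurable η)
    (h01 : ∀ x, η x ∈ Set.Icc (0 : ℝ) 1) :
    dataLaw S p η = ((featureLaw S p).prod (volume : Measure unitInterval)).map
      fun q => (q.1, thresholdLabel (η q.1) q.2) := by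
  have := isProbabilityMeasure_featureLaw hp
  have hm : Measurable fun q : EuclideanSpace ℝ (Fin D) × unitInterval =>
      (q.1, thresholdLabel (η q.1) q.2) := measurable_fst.prodMk (measurable_thresholdLabel hη)
  have hc : ∀ c : ℝ, Measurable fun x : EuclideanSpace ℝ (Fin D) => (x, c) := fun c => by fun_prop
  ext s hs
  rw [dataLaw, Measure.add_apply, Measure.map_apply (hc 1) hs, Measure.map_apply (hc 0) hs,
    withDensity_apply _ (hc 1 hs), withDensity_apply _ (hc 0 hs), Measure.map_apply hm hs,
    Measure.prod_apply (hm hs), ← lintegral_indicator (hc 1 hs), ← lintegral_indicator (hc 0 hs),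
    ← lintegral_add_left]
  swap
  · exact (Measurable.ennreal_ofReal hη).indicator (hc 1 hs)
  refine lintegral_congr fun x => ?_
  have hsplit : (Prod.mk x ⁻¹' ((fun q : EuclideanSpace ℝ (Fin D) × unitInterval =>
      (q.1, thresholdLabel (η q.1) q.2)) ⁻¹' s)) =
      ({u : unitInterval | (u : ℝ) ≤ η x} ∩ {_u | (x, (1 : ℝ)) ∈ s}) ∪
        ({u : unitInterval | ¬ (u : ℝ) ≤ η x} ∩ {_u | (x, (0 : ℝ)) ∈ s}) := by
    ext u
    by_cases hu : (u : ℝ) ≤ η x <;> simp [thresholdLabel, hu, -not_le]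
  have hle : MeasurableSet {u : unitInterval | (u : ℝ) ≤ η x} :=
    measurableSet_le (by fun_prop) (by fun_prop)
  rw [hsplit, measure_union]
  · congr 1
    · by_cases h : (x, (1 : ℝ)) ∈ s <;> simp [Set.indicator, h, volume_unitInterval_coe_le (h01 x)]
    · by_cases h : (x, (0 : ℝ)) ∈ s
      · have := volume_unitInterval_not_coe_le (h01 x)
        simp [Set.indicator, h] at this ⊢
        exact this.symm
      · simp [Set.indicator, h]
  · rw [Set.disjoint_left]
    rintro u ⟨h1, -⟩ ⟨h2, -⟩
    exact h2 h1
  · exact hle.compl.inter (MeasurableSet.const _)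

theorem isProbabilityMeasure_dataLaw (hp : IsDensityOn S p) (hη : Measurable η)
    (h01 : ∀ x, η x ∈ Set.Icc (0 : ℝ) 1) : IsProbabilityMeasure (dataLaw S p η) := by
  have := isProbabilityMeasure_featureLaw hp
  rw [dataLaw_eq_map hp hη h01]
  exact Measure.isProbabilityMeasure_map
    (measurable_fst.prodMk (measurable_thresholdLabel hη)).aemeasurable

/-- The sample is obtained from independent features and independent uniform variables. -/
theorem sampleLaw_eq_map (hp : IsDensityOn S p) (hη : Measurable η)
    (h01 : ∀ x, η x ∈ Set.Icc (0 : ℝ) 1) (n : ℕ) :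
    sampleLaw S p η n = ((Measure.pi fun _ : Fin n => featureLaw S p).prod
      (Measure.pi fun _ : Fin n => (volume : Measure unitInterval))).map
        fun q i => (q.1 i, thresholdLabel (η (q.1 i)) (q.2 i)) := by
  have := isProbabilityMeasure_featureLaw hp
  have := isProbabilityMeasure_dataLaw hp hη h01
  have hm : Measurable fun q : EuclideanSpace ℝ (Fin D) × unitInterval =>
      (q.1, thresholdLabel (η q.1) q.2) := measurable_fst.prodMk (measurable_thresholdLabel hη)
  rw [← (measurePreserving_arrowProdEquivProdArrow _ _ (Fin n) (fun _ => featureLaw S p)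
    (fun _ => (volume : Measure unitInterval))).map_eq, Measure.map_map]
  · have h2 := dataLaw_eq_map hp hη h01
    have : ∀ _ : Fin n, SigmaFinite (((featureLaw S p).prod (volume : Measure unitInterval)).map
        fun q => (q.1, thresholdLabel (η q.1) q.2)) := fun _ => by
      rw [← h2]; infer_instance
    rw [sampleLaw, h2]
    exact (Measure.pi_map_pi (μ := fun _ : Fin n => (featureLaw S p).prod
      (volume : Measure unitInterval)) fun _ => hm.aemeasurable).symm
  · refine measurable_pi_lambda _ fun i => ?_
    have hi : Measurable fun q : (Fin n → EuclideanSpace ℝ (Fin D)) × (Fin n → unitInterval) =>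
        (q.1 i, q.2 i) := by fun_prop
    exact hm.comp hi
  · exact (MeasurableEquiv.arrowProdEquivProdArrow _ _ _).measurable

theorem isProbabilityMeasure_sampleLaw (hp : IsDensityOn S p) (hη : Measurable η)
    (h01 : ∀ x, η x ∈ Set.Icc (0 : ℝ) 1) (n : ℕ) : IsProbabilityMeasure (sampleLaw S p η n) := by
  have := isProbabilityMeasure_dataLaw hp hη h01
  unfold sampleLaw
  infer_instance

theorem sampleLaw_congr (hS : MeasurableSet S) (h : ∀ x ∈ S, η x = η' x) (n : ℕ) :
    sampleLaw S p η n = sampleLaw S p η' n := by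
  rw [sampleLaw, sampleLaw, dataLaw_congr hS h]

/-- The features of the sample are independent with law `featureLaw S p`. -/
theorem sampleLaw_map_fst (hp : IsDensityOn S p) (hη : Measurable η)
    (h01 : ∀ x, η x ∈ Set.Icc (0 : ℝ) 1) (n : ℕ) :
    (sampleLaw S p η n).map (fun z i => (z i).1) = Measure.pi fun _ => featureLaw S p := by
  have := isProbabilityMeasure_featureLaw hp
  rw [sampleLaw_eq_map hp hη h01, Measure.map_map]
  · exact Measure.map_fst_prod.trans (by simp)
  · fun_prop
  · refine measurable_pi_lambda _ fun i => ?_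
    have hi : Measurable fun q : (Fin n → EuclideanSpace ℝ (Fin D)) × (Fin n → unitInterval) =>
        (q.1 i, q.2 i) := by fun_prop
    exact (measurable_fst.prodMk (measurable_thresholdLabel hη)).comp hi

end DataLaw

/-! ### Concentration of label averages for fixed features. -/

section Hoeffding

theorem integral_thresholdLabel {a : ℝ} (ha : a ∈ Set.Icc (0 : ℝ) 1) :
    ∫ u : unitInterval, thresholdLabel a u = a := by
  have hle : MeasurableSet {u : unitInterval | (u : ℝ) ≤ a} :=
    measurableSet_le (by fun_prop) (by fun_prop)
  have : (fun u : unitInterval => thresholdLabel a u) =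
      Set.indicator {u : unitInterval | (u : ℝ) ≤ a} (fun _ => (1 : ℝ)) := by
    ext u; simp [thresholdLabel, Set.indicator]
  rw [this, integral_indicator hle]
  simp [Measure.real, volume_unitInterval_coe_le ha, ha.1]

open ProbabilityTheory in
/-- **Hoeffding's inequality** for sums of independent labels with given probabilities. -/
theorem measure_sum_thresholdLabel_ge_le {n : ℕ} {a : Fin n → ℝ}
    (ha : ∀ i, a i ∈ Set.Icc (0 : ℝ) 1) (I : Finset (Fin n)) {t : ℝ} (ht : 0 ≤ t) :
    (Measure.pi fun _ : Fin n => (volume : Measure unitInterval))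
      {u | t * I.card ≤ |∑ i ∈ I, (thresholdLabel (a i) (u i) - a i)|} ≤
      ENNReal.ofReal (2 * Real.exp (-(2 * t ^ 2 * I.card))) := by
  set P := Measure.pi fun _ : Fin n => (volume : Measure unitInterval)
  have hmeas : ∀ i, Measurable fun u : unitInterval => thresholdLabel (a i) u := fun i => by
    unfold thresholdLabel
    exact Measurable.ite (measurableSet_le (by fun_prop) (by fun_prop)) measurable_const
      measurable_const
  have hsub : ∀ i, HasSubgaussianMGF (fun u : Fin n → unitInterval =>
      thresholdLabel (a i) (u i) - a i) ((‖(1 : ℝ) - 0‖₊ / 2) ^ 2) P := fun i => by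
    have hX : AEMeasurable (fun u : Fin n → unitInterval => thresholdLabel (a i) (u i)) P :=
      ((hmeas i).comp (measurable_pi_apply i)).aemeasurable
    have h1 := hasSubgaussianMGF_of_mem_Icc (a := 0) (b := 1) hX
      (ae_of_all _ fun u => thresholdLabel_mem_Icc _ _)
    have h2 : ∫ u, thresholdLabel (a i) (u i) ∂P = a i := by
      rw [integral_comp_eval (μ := fun _ : Fin n => (volume : Measure unitInterval)) (i := i)
        (f := fun v => thresholdLabel (a i) v) (hmeas i).aestronglyMeasurable,
        integral_thresholdLabel (ha i)]
    rwa [h2] at h1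
  have hind : iIndepFun (fun i (u : Fin n → unitInterval) => thresholdLabel (a i) (u i) - a i) P :=
    iIndepFun_pi (X := fun i u => thresholdLabel (a i) u - a i)
      fun i => ((hmeas i).sub_const _).aemeasurable
  have hind' : iIndepFun
      (fun i (u : Fin n → unitInterval) => -(thresholdLabel (a i) (u i) - a i)) P :=
    iIndepFun_pi (X := fun i u => -(thresholdLabel (a i) u - a i))
      fun i => ((hmeas i).sub_const _).neg.aemeasurable
  have hε : 0 ≤ t * I.card := by positivity
  have key : Real.exp (-(t * I.card) ^ 2 / (2 * ((∑ i ∈ I, (‖(1 : ℝ) - 0‖₊ / 2) ^ 2 : NNReal) : ℝ))) =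
      Real.exp (-(2 * t ^ 2 * I.card)) := by
    congr 1
    -- Each label has variance proxy `1 / 4`. For empty `I` the left exponent is a division by zero,
    -- which takes the value `0` and so agrees with the right one.
    rcases Nat.eq_zero_or_pos I.card with h0 | h0
    · simp [h0]
    · have : (I.card : ℝ) ≠ 0 := by positivity
      simp
      field_simp
  have h1 := HasSubgaussianMGF.measure_sum_ge_le_of_iIndepFun hind (s := I)
    (fun i _ => hsub i) hε
  have h2 := HasSubgaussianMGF.measure_sum_ge_le_of_iIndepFun hind' (s := I)
    (fun i _ => (hsub i).neg) hε
  rw [key] at h1 h2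
  have hcover : {u : Fin n → unitInterval |
      t * I.card ≤ |∑ i ∈ I, (thresholdLabel (a i) (u i) - a i)|} ⊆
      {u | t * I.card ≤ ∑ i ∈ I, (thresholdLabel (a i) (u i) - a i)} ∪
      {u | t * I.card ≤ ∑ i ∈ I, -(thresholdLabel (a i) (u i) - a i)} := by
    intro u hu
    rcases le_abs.1 (Set.mem_ofPred_eq ▸ hu) with h | h
    · exact Or.inl h
    · exact Or.inr (by simpa only [Set.mem_ofPred_eq, Finset.sum_neg_distrib] using h)
  refine (measure_mono hcover).trans ((measure_union_le _ _).trans ?_)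
  rw [two_mul, ENNReal.ofReal_add (Real.exp_nonneg _) (Real.exp_nonneg _)]
  exact add_le_add ((ENNReal.le_ofReal_iff_toReal_le (measure_ne_top _ _) (Real.exp_nonneg _)).2 h1)
    ((ENNReal.le_ofReal_iff_toReal_le (measure_ne_top _ _) (Real.exp_nonneg _)).2 h2)

end Hoeffding

/-! ### The Vapnik–Chervonenkis dimension of balls. -/

section BallCut

variable {D n : ℕ}

/-- The index set `I` is cut out of the points `x` by a ball, with no point on the boundary. -/
def BallCut (x : Fin n → EuclideanSpace ℝ (Fin D)) (I : Finset (Fin n)) : Prop :=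
  ∃ (c : EuclideanSpace ℝ (Fin D)) (ρ : ℝ), 0 < ρ ∧
    ∀ i, (i ∈ I → dist (x i) c < ρ) ∧ (i ∉ I → ρ < dist (x i) c)

/-- Strict inequalities on both sides make each condition open in the points, so the uncountable
union over balls is still open, hence measurable. -/
theorem isOpen_setOf_ballCut (I : Finset (Fin n)) :
    IsOpen {x : Fin n → EuclideanSpace ℝ (Fin D) | BallCut x I} := by
  have : {x : Fin n → EuclideanSpace ℝ (Fin D) | BallCut x I} =
      ⋃ (c : EuclideanSpace ℝ (Fin D)) (ρ : ℝ) (_ : 0 < ρ),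
        ⋂ i, {x | (i ∈ I → dist (x i) c < ρ) ∧ (i ∉ I → ρ < dist (x i) c)} := by
    ext x; simp [BallCut]
  rw [this]
  refine isOpen_iUnion fun c => isOpen_iUnion fun ρ => isOpen_iUnion fun _ =>
    isOpen_iInter_of_finite fun i => ?_
  by_cases hi : i ∈ I
  · simpa [hi] using isOpen_lt (f := fun x : Fin n → EuclideanSpace ℝ (Fin D) => dist (x i) c)
      (by fun_prop) continuous_const
  · simpa [hi] using isOpen_lt (g := fun x : Fin n → EuclideanSpace ℝ (Fin D) => dist (x i) c)
      continuous_const (by fun_prop)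

open Classical in
/-- The family of index sets cut out of the points `x` by balls. -/
noncomputable def ballCutFamily (x : Fin n → EuclideanSpace ℝ (Fin D)) :
    Finset (Finset (Fin n)) :=
  Finset.univ.filter (BallCut x)

/-- Balls in `ℝ^D` shatter at most `D + 2` points. -/
theorem card_le_of_shatters_ballCutFamily {x : Fin n → EuclideanSpace ℝ (Fin D)}
    {A : Finset (Fin n)} (hA : (ballCutFamily x).Shatters A) : A.card ≤ D + 2 := by
  -- The function `dist (x i) c ^ 2 - ρ ^ 2` is linear in this lift, whose target has dimension `D +
  -- 2`.
  let v : A → ℝ × ℝ × EuclideanSpace ℝ (Fin D) := fun i => (1, ‖x i‖ ^ 2, x i)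
  by_cases hli : LinearIndependent ℝ v
  · have := hli.fintype_card_le_finrank
    simp at this
    omega
  obtain ⟨g, hg, i₀, hi₀⟩ := Fintype.not_linearIndependent_iff.1 hli
  have hg1 : ∑ i, g i = 0 := by
    have := congrArg Prod.fst hg
    simpa [v, Prod.fst_sum] using this
  have hg2 : ∑ i : A, g i * ‖x i‖ ^ 2 = 0 := by
    have := congrArg (fun q => q.2.1) hg
    simpa [v, Prod.snd_sum, Prod.fst_sum] using this
  have hg3 : ∑ i : A, g i • x i = 0 := by
    have := congrArg (fun q => q.2.2) hg
    simpa [v, Prod.snd_sum] using this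
  obtain ⟨j, -, hj⟩ := Finset.exists_pos_of_sum_zero_of_exists_nonzero g hg1
    ⟨i₀, Finset.mem_univ _, hi₀⟩
  classical
  -- A ball cutting out exactly the points with `g i ≤ 0` makes every product `g i * (dist (x i) c ^
  -- 2 - ρ ^ 2)` nonnegative, and positive at `j`; but the linear relation makes their sum vanish.
  obtain ⟨u, hu, hut⟩ := hA (t := (Finset.univ.filter fun i => g i ≤ 0).map
    (Function.Embedding.subtype _)) (fun i hi => by
      obtain ⟨a, -, rfl⟩ := Finset.mem_map.1 hi
      exact a.2)
  have hmem : ∀ i : A, (i : Fin n) ∈ u ↔ g i ≤ 0 := fun i => by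
    have : (i : Fin n) ∈ A ∩ u ↔ g i ≤ 0 := by rw [hut]; simp
    simpa using this
  obtain ⟨c, ρ, hρ, hc⟩ := (Finset.mem_filter.1 hu).2
  have hexp : ∀ i, dist (x i) c ^ 2 = ‖x i‖ ^ 2 - 2 * inner ℝ (x i) c + ‖c‖ ^ 2 := fun i => by
    rw [dist_eq_norm, norm_sub_sq_real]
  have hinner : ∑ i : A, g i * inner ℝ (x i) c = 0 := by
    have := congrArg (fun y => inner ℝ y c) hg3
    simpa [sum_inner, inner_smul_left] using this
  have hzero : ∑ i : A, g i * (dist (x i) c ^ 2 - ρ ^ 2) = 0 := by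
    have : ∀ i : A, g i * (dist (x i) c ^ 2 - ρ ^ 2) =
        g i * ‖x i‖ ^ 2 - 2 * (g i * inner ℝ (x i) c) + (‖c‖ ^ 2 - ρ ^ 2) * g i := fun i => by
      rw [hexp]; ring
    rw [Finset.sum_congr rfl fun i _ => this i, Finset.sum_add_distrib, Finset.sum_sub_distrib,
      ← Finset.mul_sum, ← Finset.mul_sum, hg1, hg2, hinner]
    simp
  have hpos : 0 < ∑ i : A, g i * (dist (x i) c ^ 2 - ρ ^ 2) := by
    refine Finset.sum_pos' (fun i _ => ?_) ⟨j, Finset.mem_univ _, ?_⟩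
    · by_cases hi : g i ≤ 0
      · have := (hc i).1 ((hmem i).2 hi)
        exact mul_nonneg_of_nonpos_of_nonpos hi (by nlinarith [dist_nonneg (x := x i) (y := c)])
      · have := (hc i).2 (mt (hmem i).1 hi)
        exact mul_nonneg (not_le.1 hi).le (by nlinarith)
    · have := (hc j).2 (mt (hmem j).1 (not_le.2 hj))
      exact mul_pos hj (by nlinarith)
  exact absurd hzero hpos.ne'

/-- Termwise comparison with the binomial expansion: `n.choose k ≤ n ^ k ≤ n ^ k * d.choose k`. -/
theorem sum_Iic_choose_le_pow (n d : ℕ) : ∑ k ∈ Finset.Iic d, n.choose k ≤ (n + 1) ^ d := by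
  rw [add_pow, ← Nat.range_succ_eq_Iic]
  refine Finset.sum_le_sum fun k hk => ?_
  have h1 := Nat.choose_le_pow n k
  have h2 : 0 < d.choose k := Nat.choose_pos (by simpa [Nat.lt_succ_iff] using hk)
  simp only [one_pow, mul_one]
  exact h1.trans (Nat.le_mul_of_pos_right _ h2)

/-- Balls cut at most polynomially many index sets out of `n` points. -/
theorem card_ballCutFamily_le (x : Fin n → EuclideanSpace ℝ (Fin D)) :
    (ballCutFamily x).card ≤ (n + 1) ^ (D + 2) := by
  have hvc : (ballCutFamily x).vcDim ≤ D + 2 :=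
    Finset.sup_le fun A hA => card_le_of_shatters_ballCutFamily (Finset.mem_shatterer.1 hA)
  refine (Finset.card_le_card_shatterer _).trans
    (Finset.card_shatterer_le_sum_vcDim.trans ?_)
  rw [Fintype.card_fin]
  refine le_trans ?_ (sum_Iic_choose_le_pow n (D + 2))
  exact Finset.sum_le_sum_of_subset (Finset.Iic_subset_Iic.2 hvc)

end BallCut

/-! ### Uniform control of the label noise. -/

section UniformDeviation

variable {D : ℕ} {S : Set (EuclideanSpace ℝ (Fin D))} {p η : EuclideanSpace ℝ (Fin D) → ℝ}

/-- The event that the labels over some set of at least `k` sample points cut out by a ball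
deviate by at least `t` on average from the label probabilities. -/
def deviationEvent (η : EuclideanSpace ℝ (Fin D) → ℝ) (n k : ℕ) (t : ℝ) :
    Set (Fin n → EuclideanSpace ℝ (Fin D) × ℝ) :=
  ⋃ I : Finset (Fin n), {z | BallCut (fun i => (z i).1) I ∧ k ≤ I.card ∧
    t * I.card ≤ |∑ i ∈ I, ((z i).2 - η (z i).1)|}

theorem measurableSet_deviationEvent (hη : Measurable η) (n k : ℕ) (t : ℝ) :
    MeasurableSet (deviationEvent η n k t) := by
  refine MeasurableSet.iUnion fun I => ?_
  have h1 : MeasurableSet {z : Fin n → EuclideanSpace ℝ (Fin D) × ℝ |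
      BallCut (fun i => (z i).1) I} :=
    (show Measurable fun (z : Fin n → EuclideanSpace ℝ (Fin D) × ℝ) i => (z i).1 by fun_prop)
      (isOpen_setOf_ballCut I).measurableSet
  have h2 : MeasurableSet {z : Fin n → EuclideanSpace ℝ (Fin D) × ℝ |
      t * I.card ≤ |∑ i ∈ I, ((z i).2 - η (z i).1)|} :=
    measurableSet_le measurable_const (by
      refine Measurable.abs (Finset.measurable_sum _ fun i _ => ?_)
      have hi : Measurable fun z : Fin n → EuclideanSpace ℝ (Fin D) × ℝ => (z i).1 := by fun_prop
      exact Measurable.sub (by fun_prop) (hη.comp hi))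
  exact h1.inter ((MeasurableSet.const _).inter h2)

/-- With the features frozen, the sets that balls can cut out form a deterministic family of
polynomial size. Hoeffding applies to each member, the union bound to the family, and the estimate
is integrated over the features. -/
theorem sampleLaw_deviationEvent_le (hp : IsDensityOn S p) (hη : Measurable η)
    (h01 : ∀ x, η x ∈ Set.Icc (0 : ℝ) 1) (n k : ℕ) {t : ℝ} (ht : 0 ≤ t) :
    sampleLaw S p η n (deviationEvent η n k t) ≤
      ((n + 1) ^ (D + 2) : ℕ) * ENNReal.ofReal (2 * Real.exp (-(2 * t ^ 2 * k))) := by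
  have := isProbabilityMeasure_featureLaw hp
  have hmap : Measurable fun (q : (Fin n → EuclideanSpace ℝ (Fin D)) × (Fin n → unitInterval)) i =>
      (q.1 i, thresholdLabel (η (q.1 i)) (q.2 i)) := by
    refine measurable_pi_lambda _ fun i => ?_
    have hi : Measurable fun q : (Fin n → EuclideanSpace ℝ (Fin D)) × (Fin n → unitInterval) =>
        (q.1 i, q.2 i) := by fun_prop
    exact (measurable_fst.prodMk (measurable_thresholdLabel hη)).comp hi
  have hmeas := measurableSet_deviationEvent hη n k t
  rw [sampleLaw_eq_map hp hη h01, Measure.map_apply hmap hmeas, Measure.prod_apply (hmap hmeas)]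
  refine (lintegral_mono (g := fun _ => ((n + 1) ^ (D + 2) : ℕ) *
    ENNReal.ofReal (2 * Real.exp (-(2 * t ^ 2 * k)))) fun x => ?_).trans (by simp)
  have hsub : Prod.mk x ⁻¹' ((fun (q : (Fin n → EuclideanSpace ℝ (Fin D)) ×
      (Fin n → unitInterval)) i => (q.1 i, thresholdLabel (η (q.1 i)) (q.2 i))) ⁻¹'
        deviationEvent η n k t) ⊆
      ⋃ I ∈ ballCutFamily x, {u | k ≤ I.card ∧
        t * I.card ≤ |∑ i ∈ I, (thresholdLabel (η (x i)) (u i) - η (x i))|} := by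
    intro u hu
    obtain ⟨I, hI⟩ := Set.mem_iUnion.1 hu
    exact Set.mem_iUnion₂.2 ⟨I, by simpa [ballCutFamily] using hI.1, hI.2⟩
  refine (measure_mono hsub).trans ((measure_biUnion_finset_le _ _).trans ?_)
  refine (Finset.sum_le_card_nsmul _ _
    (ENNReal.ofReal (2 * Real.exp (-(2 * t ^ 2 * k)))) fun I _ => ?_).trans ?_
  · by_cases hk : k ≤ I.card
    · simp only [hk, true_and]
      refine (measure_sum_thresholdLabel_ge_le (fun i => h01 (x i)) I ht).trans
        (ENNReal.ofReal_le_ofReal ?_)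
      have : (k : ℝ) ≤ I.card := by exact_mod_cast hk
      gcongr
    · simp [hk]
  · rw [nsmul_eq_mul]
    exact mul_le_mul' (by exact_mod_cast card_ballCutFamily_le x) le_rfl

end UniformDeviation

/-! ### Chernoff bound and nets. -/

section Counting

open Classical in
/-- A **Chernoff bound** for the number of points of an independent sample in a set. -/
theorem measure_pi_card_lt_le {Ω : Type*} [MeasurableSpace Ω] {μ : Measure Ω}
    [IsProbabilityMeasure μ] {A : Set Ω} (hA : MeasurableSet A) (n k : ℕ)
    (hk : 3 / 2 * (k : ℝ) ≤ n * μ.real A) :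
    (Measure.pi fun _ : Fin n => μ) {x | (Finset.univ.filter fun i => x i ∈ A).card < k} ≤
      ENNReal.ofReal (Real.exp (-(k / 12))) := by
  set P := Measure.pi fun _ : Fin n => μ
  -- Exponential moment at parameter `-1 / 3`. From `b ≤ 13 / 18` each coordinate contributes at
  -- most `exp (-(5 / 18) * μ.real A)`, in total `exp (-(5 / 12) * k)`; Markov at level `exp (-k /
  -- 3)` leaves `5 / 12 - 1 / 3 = 1 / 12`.
  set b : ℝ := Real.exp (-(1 / 3)) with hb
  let f : Ω → ℝ := A.indicator (fun _ => b - 1) + fun _ => 1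
  have hf : Integrable f μ := ((integrable_const _).indicator hA).add (integrable_const _)
  have hfint : ∫ y, f y ∂μ ≤ Real.exp (-(5 / 18 * μ.real A)) := by
    have h1 : ∫ y, f y ∂μ = μ.real A * (b - 1) + 1 := by
      simp only [f, Pi.add_apply]
      rw [integral_add ((integrable_const _).indicator hA) (integrable_const _),
        integral_indicator_const _ hA]
      simp
    have h2 : b ≤ 13 / 18 := by
      rw [hb, Real.exp_neg, inv_le_comm₀ (Real.exp_pos _) (by norm_num)]
      have := Real.quadratic_le_exp_of_nonneg (x := 1 / 3) (by norm_num)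
      refine le_trans (by norm_num) this
    rw [h1]
    refine le_trans ?_ (Real.add_one_le_exp _)
    nlinarith [measureReal_nonneg (μ := μ) (s := A)]
  have hfnonneg : ∀ y, 0 ≤ f y := fun y => by
    by_cases hy : y ∈ A <;> simp [f, hy, hb, Real.exp_nonneg]
  have hF : Integrable (fun x : Fin n → Ω => ∏ i, f (x i)) P :=
    Integrable.fintype_prod fun _ => hf
  have hFint : ∫ x, ∏ i, f (x i) ∂P ≤ Real.exp (-(5 / 12 * k)) := by
    rw [integral_fintype_prod_eq_pow (ι := Fin n) f, Fintype.card_fin]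
    refine (pow_le_pow_left₀ (integral_nonneg hfnonneg) hfint n).trans ?_
    rw [← Real.exp_nat_mul]
    refine Real.exp_le_exp.2 ?_
    nlinarith
  have hsub : {x : Fin n → Ω | (Finset.univ.filter fun i => x i ∈ A).card < k} ⊆
      {x | Real.exp (-(k / 3)) ≤ ∏ i, f (x i)} := by
    intro x hx
    have hprod : ∏ i, f (x i) = b ^ (Finset.univ.filter fun i => x i ∈ A).card := by
      rw [Finset.card_filter, ← Finset.prod_pow_eq_pow_sum]
      refine Finset.prod_congr rfl fun i _ => ?_
      by_cases hi : x i ∈ A <;> simp [f, hi]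
    have hx' : ((Finset.univ.filter fun i => x i ∈ A).card : ℝ) ≤ k := by
      exact_mod_cast (show _ < k from hx).le
    rw [Set.mem_ofPred_eq, hprod, hb, ← Real.exp_nat_mul]
    refine Real.exp_le_exp.2 ?_
    linarith
  refine (measure_mono hsub).trans ?_
  rw [ENNReal.le_ofReal_iff_toReal_le (measure_ne_top _ _) (Real.exp_nonneg _)]
  have hM := mul_meas_ge_le_integral_of_nonneg (μ := P)
    (ae_of_all _ fun x => Finset.prod_nonneg fun i _ => hfnonneg (x i)) hF (Real.exp (-(k / 3)))
  have h3 : P.real {x | Real.exp (-(k / 3)) ≤ ∏ i, f (x i)} ≤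
      Real.exp (k / 3) * Real.exp (-(5 / 12 * k)) := by
    rw [← div_le_iff₀' (Real.exp_pos _), div_eq_mul_inv, ← Real.exp_neg, mul_comm]
    exact hM.trans hFint
  rw [← Real.exp_add] at h3
  refine h3.trans (Real.exp_le_exp.2 ?_)
  linarith

/-- A set whose points are centres of balls of mass at least `q` has a small net. -/
theorem exists_finset_net {E : Type*} [MetricSpace E] [MeasurableSpace E] [BorelSpace E]
    {μ : Measure E} [IsProbabilityMeasure μ] {S : Set E} {s q : ℝ} (hs : 0 < s) (hq : 0 < q)
    (hμ : ∀ x ∈ S, q ≤ μ.real (Metric.closedBall x (s / 3))) :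
    ∃ N : Finset E, ↑N ⊆ S ∧ (N.card : ℝ) * q ≤ 1 ∧ ∀ x ∈ S, ∃ c ∈ N, dist x c ≤ s := by
  classical
  -- An `s`-separated set carries disjoint balls of radius `s / 3`, so its size is at most `1 / q`;
  -- one of largest size must be an `s`-net.
  let G : Set (Finset E) := {N | ↑N ⊆ S ∧ ∀ x ∈ N, ∀ y ∈ N, x ≠ y → s < dist x y}
  have hcard : ∀ N ∈ G, (N.card : ℝ) * q ≤ 1 := by
    intro N hN
    have hdisj : (N : Set E).PairwiseDisjoint fun c => Metric.closedBall c (s / 3) := by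
      intro x hx y hy hxy
      refine Metric.closedBall_disjoint_closedBall ?_
      linarith [hN.2 x hx y hy hxy]
    have h1 : μ.real (⋃ c ∈ N, Metric.closedBall c (s / 3)) =
        ∑ c ∈ N, μ.real (Metric.closedBall c (s / 3)) :=
      measureReal_biUnion_finset hdisj fun _ _ => measurableSet_closedBall
    have h2 : μ.real (⋃ c ∈ N, Metric.closedBall c (s / 3)) ≤ 1 := measureReal_le_one
    rw [h1] at h2
    rw [← nsmul_eq_mul]
    exact (Finset.card_nsmul_le_sum _ _ _ fun c hc => hμ c (hN.1 hc)).trans h2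
  have hbdd : BddAbove (Finset.card '' G) := by
    refine ⟨⌊1 / q⌋₊, ?_⟩
    rintro _ ⟨N, hN, rfl⟩
    exact Nat.le_floor ((le_div_iff₀ hq).2 (hcard N hN))
  have hne : (Finset.card '' G).Nonempty := ⟨_, ∅, ⟨by simp, by simp⟩, rfl⟩
  obtain ⟨N, hN, hmax⟩ := Nat.sSup_mem hne hbdd
  refine ⟨N, hN.1, hcard N hN, fun x hx => ?_⟩
  by_contra! hcon
  have hxN : x ∉ N := fun h => by simpa using (hcon x h).trans' hs
  have hins : insert x N ∈ G := by
    refine ⟨by simpa [Set.insert_subset_iff] using ⟨hx, hN.1⟩, ?_⟩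
    intro a ha b hb hab
    rcases Finset.mem_insert.1 ha with ha' | ha' <;> rcases Finset.mem_insert.1 hb with hb' | hb'
    · exact absurd (ha'.trans hb'.symm) hab
    · rw [ha']; exact hcon b hb'
    · rw [hb', dist_comm]; exact hcon a ha'
    · exact hN.2 a ha' b hb' hab
  have := le_csSup hbdd ⟨_, hins, rfl⟩
  rw [Finset.card_insert_of_notMem hxN, ← hmax] at this
  omega

end Counting

/-! ### Mass of balls and almost sure properties of the features. -/

section Mass

variable {D : ℕ} {S : Set (EuclideanSpace ℝ (Fin D))} {p η : EuclideanSpace ℝ (Fin D) → ℝ}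
  {w r₀ α C : ℝ}

theorem unitBallVolume_pos (D : ℕ) : 0 < unitBallVolume D := by
  unfold unitBallVolume
  have := Real.Gamma_pos_of_pos (s := (D : ℝ) / 2 + 1) (by positivity)
  have := Real.pi_pos
  positivity

theorem volume_closedBall_eq (hD : 1 ≤ D) (x : EuclideanSpace ℝ (Fin D)) {r : ℝ} (hr : 0 ≤ r) :
    volume (Metric.closedBall x r) = ENNReal.ofReal (unitBallVolume D * r ^ D) := by
  have : Nonempty (Fin D) := ⟨⟨0, hD⟩⟩
  rw [EuclideanSpace.volume_closedBall, Fintype.card_fin, mul_comm, ← ENNReal.ofReal_pow hr,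
    ← ENNReal.ofReal_mul' (by positivity), unitBallVolume, Real.sqrt_eq_rpow, ← Real.rpow_natCast,
    ← Real.rpow_mul Real.pi_pos.le, one_div_mul_eq_div]

theorem minDensity_le (hp : IsDensityOn S p) {x : EuclideanSpace ℝ (Fin D)} (hx : x ∈ S) :
    minDensity S p ≤ p x :=
  ciInf_le (f := fun y : S => p y) ⟨0, by rintro _ ⟨y, rfl⟩; exact hp.nonneg y y.2⟩ ⟨x, hx⟩

/-- Balls centred in the support have mass of the order of their volume. -/
theorem KNNAssumption.le_featureLaw_closedBall (hD : 1 ≤ D) (hw : 0 < w)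
    (h : KNNAssumption S p η w r₀ α C) {x : EuclideanSpace ℝ (Fin D)} (hx : x ∈ S) {r : ℝ}
    (hr : 0 < r) (hr₀ : r < r₀) :
    w * unitBallVolume D * minDensity S p * r ^ D ≤
      (featureLaw S p).real (Metric.closedBall x r) := by
  have := isProbabilityMeasure_featureLaw h.density
  refine (ENNReal.ofReal_le_iff_le_toReal (measure_ne_top _ _)).1 ?_
  rw [featureLaw, withDensity_apply _ measurableSet_closedBall,
    Measure.restrict_restrict measurableSet_closedBall, Set.inter_comm]
  have h1 : ENNReal.ofReal (minDensity S p) * volume (S ∩ Metric.closedBall x r) ≤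
      ∫⁻ y in S ∩ Metric.closedBall x r, ENNReal.ofReal (p y) := by
    rw [← setLIntegral_const]
    refine setLIntegral_mono' (h.compact.measurableSet.inter measurableSet_closedBall) ?_
    exact fun y hy => ENNReal.ofReal_le_ofReal (minDensity_le h.density hy.1)
  refine le_trans ?_ h1
  refine le_trans ?_ (mul_le_mul_right (h.regular x hx r hr hr₀) _)
  rw [volume_closedBall_eq hD x hr.le, ← ENNReal.ofReal_mul hw.le,
    ← ENNReal.ofReal_mul h.minDensity_pos.le]
  exact ENNReal.ofReal_le_ofReal (le_of_eq (by ring))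

/-- The feature law has no atoms, so the diagonal is null for the product of two copies. Without
ties, counting sample points and counting indices agree. -/
theorem ae_injective_pi_featureLaw (hD : 1 ≤ D) (hp : IsDensityOn S p) (n : ℕ) :
    ∀ᵐ x ∂(Measure.pi fun _ : Fin n => featureLaw S p), Function.Injective x := by
  have := isProbabilityMeasure_featureLaw hp
  have : Nonempty (Fin D) := ⟨⟨0, hD⟩⟩
  have hpair : ∀ i j : Fin n, i ≠ j →
      ∀ᵐ x ∂(Measure.pi fun _ : Fin n => featureLaw S p), x i ≠ x j := by
    intro i j hij
    have hind := (ProbabilityTheory.iIndepFun_pi (μ := fun _ : Fin n => featureLaw S p)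
      (X := fun _ y => y) fun _ => aemeasurable_id).indepFun hij
    have hmap := (ProbabilityTheory.indepFun_iff_map_prod_eq_prod_map_map
      (measurable_pi_apply i).aemeasurable (measurable_pi_apply j).aemeasurable).1 hind
    have hev : ∀ l : Fin n, (Measure.pi fun _ : Fin n => featureLaw S p).map (fun x => x l) =
        featureLaw S p := fun l => (measurePreserving_eval (fun _ => featureLaw S p) l).map_eq
    rw [hev, hev] at hmap
    have hdiag : MeasurableSet {q : EuclideanSpace ℝ (Fin D) × EuclideanSpace ℝ (Fin D) |
        q.1 = q.2} := measurableSet_eq_fun measurable_fst measurable_snd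
    have hnull : ((featureLaw S p).prod (featureLaw S p))
        {q : EuclideanSpace ℝ (Fin D) × EuclideanSpace ℝ (Fin D) | q.1 = q.2} = 0 := by
      rw [Measure.prod_apply hdiag]
      refine lintegral_eq_zero_of_ae_eq_zero (ae_of_all _ fun y => ?_)
      have : Prod.mk y ⁻¹' {q : EuclideanSpace ℝ (Fin D) × EuclideanSpace ℝ (Fin D) |
          q.1 = q.2} = {y} := by ext; simp [eq_comm]
      simp only [this]
      exact featureLaw_absolutelyContinuous (measure_singleton y)
    rw [← hmap, Measure.map_apply (by fun_prop) hdiag] at hnull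
    rw [ae_iff]
    simpa using hnull
  have hall : ∀ᵐ x ∂(Measure.pi fun _ : Fin n => featureLaw S p), ∀ i j, i ≠ j → x i ≠ x j := by
    simp only [ae_all_iff]
    exact hpair
  exact hall.mono fun x hx i j hij => not_imp_not.1 (hx i j) hij

theorem ae_mem_pi_featureLaw (hS : MeasurableSet S) (hp : IsDensityOn S p) (n : ℕ) :
    ∀ᵐ x ∂(Measure.pi fun _ : Fin n => featureLaw S p), ∀ i, x i ∈ S := by
  have := isProbabilityMeasure_featureLaw hp
  exact ae_all_iff.2 fun i => (Measure.quasiMeasurePreserving_eval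
    (fun _ : Fin n => featureLaw S p) i).ae (ae_mem_featureLaw hS)

theorem IsHolderLabel.continuousOn (h : IsHolderLabel S η α C) (hα : 0 < α) :
    ContinuousOn η S := by
  intro x hx
  rw [ContinuousWithinAt, tendsto_iff_dist_tendsto_zero]
  have hlim : Filter.Tendsto (fun y => C * dist y x ^ α) (nhdsWithin x S) (nhds 0) := by
    have hc : Continuous fun y => C * dist y x ^ α :=
      continuous_const.mul ((continuous_id.dist continuous_const).rpow_const fun _ => Or.inr hα.le)
    have := (hc.tendsto x).mono_left (nhdsWithin_le_nhds (s := S))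
    simpa [Real.zero_rpow hα.ne'] using this
  refine squeeze_zero' (Filter.Eventually.of_forall fun _ => dist_nonneg) ?_ hlim
  filter_upwards [self_mem_nhdsWithin] with y hy
  exact h.holder y hy x hx

/-- Nothing is assumed about `η` off `S`; extending by zero gives the measurable representative used
in the probabilistic arguments. -/
theorem IsHolderLabel.measurable_indicator (h : IsHolderLabel S η α C) (hα : 0 < α)
    (hS : MeasurableSet S) : Measurable (S.indicator η) := by
  classical
  rw [← Set.piecewise_eq_indicator]
  exact (h.continuousOn hα).measurable_piecewise continuousOn_const hS

theorem IsHolderLabel.indicator_mem_Icc (h : IsHolderLabel S η α C)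
    (x : EuclideanSpace ℝ (Fin D)) : S.indicator η x ∈ Set.Icc (0 : ℝ) 1 := by
  by_cases hx : x ∈ S
  · simpa [hx] using h.mem_Icc x hx
  · simp [hx]

end Mass

/-! ### Neighbour sets as ball cuts; bias and noise. -/

section Nearest

variable {D n : ℕ} {S : Set (EuclideanSpace ℝ (Fin D))}
  {z : Fin n → EuclideanSpace ℝ (Fin D) × ℝ} {x : EuclideanSpace ℝ (Fin D)}

theorem mem_ballPoints_iff (hS : ∀ i, (z i).1 ∈ S) (r : ℝ) (i : Fin n) :
    (z i).1 ∈ ballPoints S z x r ↔ dist x (z i).1 ≤ r := by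
  simp [ballPoints, hS i]

theorem ncard_ballPoints (hS : ∀ i, (z i).1 ∈ S) (hz : Function.Injective fun i => (z i).1)
    (r : ℝ) : (ballPoints S z x r).ncard =
      (Finset.univ.filter fun i => dist x (z i).1 ≤ r).card := by
  classical
  rw [← Finset.card_image_of_injective _ hz, ← Set.ncard_coe_finset]
  congr 1
  ext y
  simp only [ballPoints, Finset.coe_image, Finset.coe_filter, Finset.mem_univ, true_and,
    Set.mem_inter_iff, Set.mem_image, Set.mem_ofPred_eq, Set.mem_range]
  constructor
  · rintro ⟨⟨_, h⟩, i, rfl⟩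
    exact ⟨i, h, rfl⟩
  · rintro ⟨i, h, rfl⟩
    exact ⟨⟨hS i, h⟩, i, rfl⟩

/-- If some ball of radius `r` around `x` holds at least `k` sample points, then the `k`-NN label
of `x` is the average label over a ball-cut set of at least `k` sample points in this ball. -/
theorem exists_ballCut_knnLabel_eq (hS : ∀ i, (z i).1 ∈ S)
    (hz : Function.Injective fun i => (z i).1) {k : ℕ} (hk : 1 ≤ k) {r : ℝ}
    (hr : k ≤ (Finset.univ.filter fun i => dist x (z i).1 ≤ r).card) :
    ∃ I : Finset (Fin n), BallCut (fun i => (z i).1) I ∧ k ≤ I.card ∧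
      (∀ i ∈ I, dist (z i).1 x ≤ r) ∧ knnLabel S z k x = (1 / (I.card : ℝ)) * ∑ i ∈ I, (z i).2 := by
  set J : ℝ → Finset (Fin n) := fun r => Finset.univ.filter fun i => dist x (z i).1 ≤ r with hJ
  have hR : knnRadius S z k x = sInf {r | k ≤ (J r).card} := by
    simp only [knnRadius, ncard_ballPoints hS hz, hJ]
  set R := knnRadius S z k x
  -- Here `1 ≤ k` matters: for `k = 0` every negative radius would qualify and the infimum would be
  -- meaningless.
  have hlow : ∀ r ∈ {r | k ≤ (J r).card}, 0 ≤ r := by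
    intro r hr
    obtain ⟨i, hi⟩ := Finset.card_pos.1 (hk.trans hr)
    exact dist_nonneg.trans (Finset.mem_filter.1 hi).2
  have hR0 : 0 ≤ R := hR ▸ Real.sInf_nonneg hlow
  have hRr : R ≤ r := hR ▸ csInf_le ⟨0, hlow⟩ hr
  -- With finitely many points, a radius slightly above `R` captures no new one. This shows both
  -- that the infimum `R` is attained and that the closed ball of radius `R` is cut strictly by `ρ`.
  obtain ⟨ρ, hρ, hρR⟩ : ∃ ρ, (∀ i, R < dist x (z i).1 → ρ < dist x (z i).1) ∧ R < ρ := by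
    have h1 : ∀ᶠ ρ in nhdsWithin R (Set.Ioi R), ∀ i, R < dist x (z i).1 → ρ < dist x (z i).1 := by
      rw [Filter.eventually_all]
      intro i
      by_cases hi : R < dist x (z i).1
      · filter_upwards [Ioo_mem_nhdsGT hi] with ρ hρ _ using hρ.2
      · exact Filter.Eventually.of_forall fun _ h => absurd h hi
    exact (h1.and self_mem_nhdsWithin).exists
  have hkR : k ≤ (J R).card := by
    obtain ⟨r', hr', hlt⟩ := exists_lt_of_csInf_lt (s := {r | k ≤ (J r).card}) ⟨r, hr⟩ (hR ▸ hρR)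
    refine le_trans hr' (Finset.card_le_card fun i hi => ?_)
    simp only [hJ, Finset.mem_filter, Finset.mem_univ, true_and] at hi ⊢
    by_contra! hcon
    linarith [hρ i hcon]
  refine ⟨J R, ⟨x, ρ, hR0.trans_lt hρR, fun i => ⟨fun hi => ?_, fun hi => ?_⟩⟩, hkR,
    fun i hi => ?_, ?_⟩
  · rw [dist_comm]
    exact (Finset.mem_filter.1 hi).2.trans_lt hρR
  · rw [dist_comm]
    exact hρ i (by simpa [hJ] using hi)
  · rw [dist_comm]
    exact (Finset.mem_filter.1 hi).2.trans hRr
  · rw [knnLabel, knnSet, ncard_ballPoints hS hz]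
    simp only [mem_ballPoints_iff hS, mul_ite, mul_one, mul_zero, hJ, Finset.sum_filter]
    rfl

/-- Bias–noise decomposition: `y i - b = (y i - a i) + (a i - b)`. -/
theorem abs_average_sub_le {I : Finset (Fin n)} (hI : 0 < I.card) {y a : Fin n → ℝ} {b t s : ℝ}
    (h1 : |∑ i ∈ I, (y i - a i)| ≤ t * I.card) (h2 : ∀ i ∈ I, |a i - b| ≤ s) :
    |(1 / (I.card : ℝ)) * ∑ i ∈ I, y i - b| ≤ s + t := by
  have hc : (0 : ℝ) < I.card := by exact_mod_cast hI
  have h3 : |∑ i ∈ I, (a i - b)| ≤ I.card * s :=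
    (Finset.abs_sum_le_sum_abs _ _).trans
      ((Finset.sum_le_card_nsmul _ _ _ h2).trans (by rw [nsmul_eq_mul]))
  have h4 : (1 / (I.card : ℝ)) * ∑ i ∈ I, y i - b =
      (∑ i ∈ I, (y i - a i) + ∑ i ∈ I, (a i - b)) / I.card := by
    rw [← Finset.sum_add_distrib]
    simp only [sub_add_sub_cancel, Finset.sum_sub_distrib, Finset.sum_const, nsmul_eq_mul]
    field_simp
  rw [h4, abs_div, abs_of_pos hc, div_le_iff₀ hc]
  refine (abs_add_le _ _).trans ?_
  nlinarith

end Nearest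

/-- The event need not be measurable: the witness is the complement of a measurable hull of its
complement. -/
theorem withProbAtLeast_of_measure_compl_le {Ω : Type*} [MeasurableSpace Ω] {μ : Measure Ω}
    [IsProbabilityMeasure μ] {A : Set Ω} {δ : ℝ} (hδ : 0 ≤ δ) (h : μ Aᶜ ≤ ENNReal.ofReal δ) :
    WithProbAtLeast μ (1 - δ) A := by
  refine ⟨(toMeasurable μ Aᶜ)ᶜ, (measurableSet_toMeasurable _ _).compl,
    Set.compl_subset_comm.1 (subset_toMeasurable _ _), ?_⟩
  rw [prob_compl_eq_one_sub (measurableSet_toMeasurable _ _), measure_toMeasurable,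
    ENNReal.ofReal_sub _ hδ, ENNReal.ofReal_one]
  exact tsub_le_tsub_left h _

/-! ### Numerical inequalities behind the two failure probabilities. -/

section Numerics

variable {D n k : ℕ} {δ : ℝ}

theorem log_four_div_ge (hδ₀ : 0 < δ) (hδ₁ : δ < 1) : 13 / 10 ≤ Real.log (4 / δ) := by
  have h1 : Real.log 4 ≤ Real.log (4 / δ) :=
    Real.log_le_log (by norm_num) ((le_div_iff₀ hδ₀).2 (by linarith))
  have h2 : Real.log 4 = 2 * Real.log 2 := by
    rw [show (4 : ℝ) = 2 ^ 2 by norm_num, Real.log_pow]; norm_num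
  linarith [Real.log_two_gt_d9]

theorem log_ge_of_two_le (hn : 2 ≤ n) : 69 / 100 ≤ Real.log n := by
  have h1 : Real.log 2 ≤ Real.log n := Real.log_le_log (by norm_num) (by exact_mod_cast hn)
  linarith [Real.log_two_gt_d9]

/-- Makes the factor `(12 * D) ^ D` in the size of the net at most `n ^ D`. -/
theorem twelve_mul_le_of_knn (hδ₀ : 0 < δ) (hδ₁ : δ < 1) (hk : 1 ≤ k)
    (hlow : 2 ^ 8 * (D : ℝ) * Real.log (4 / δ) ^ 2 * Real.log n ≤ k) (hkn : 3 * k ≤ 2 * n) :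
    12 * D ≤ n := by
  have h1 := log_four_div_ge hδ₀ hδ₁
  have h2 : 69 / 100 ≤ Real.log n := log_ge_of_two_le (by omega)
  have h3 : (3 : ℝ) * k ≤ 2 * n := by exact_mod_cast hkn
  have h4 : (169 / 100 : ℝ) ≤ Real.log (4 / δ) ^ 2 := by nlinarith
  have h5 : 169 / 100 * (69 / 100) ≤ Real.log (4 / δ) ^ 2 * Real.log n :=
    mul_le_mul h4 h2 (by norm_num) (by positivity)
  have h6 : (D : ℝ) * (169 / 100 * (69 / 100)) ≤ D * (Real.log (4 / δ) ^ 2 * Real.log n) :=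
    mul_le_mul_of_nonneg_left h5 (by positivity)
  have : (12 * D : ℝ) ≤ n := by nlinarith [(Nat.cast_nonneg D : (0 : ℝ) ≤ D)]
  exact_mod_cast this

/-- Failure probability of the counting event: net size times Chernoff bound. The constant `2 ^ 8`
leaves ample room after division by `12`. -/
theorem pow_mul_exp_le_of_knn (hD : 1 ≤ D) (hδ₀ : 0 < δ) (hδ₁ : δ < 1) (hn : 2 ≤ n)
    (hlow : 2 ^ 8 * (D : ℝ) * Real.log (4 / δ) ^ 2 * Real.log n ≤ k) :
    (n : ℝ) ^ (D + 1) * Real.exp (-(k / 12)) ≤ δ / 2 := by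
  have h1 := log_four_div_ge hδ₀ hδ₁
  have h2 := log_ge_of_two_le hn
  have hD' : (1 : ℝ) ≤ D := by exact_mod_cast hD
  set Λ := Real.log (4 / δ) with hΛ
  set L := Real.log n
  have hpos : (0 : ℝ) < n := by positivity
  have hsq : 1 ≤ Λ ^ 2 := by nlinarith
  have e1 : (D + 1 : ℝ) * L ≤ 2 * (D * Λ ^ 2 * L) := by
    have : (D : ℝ) * 1 * L ≤ D * Λ ^ 2 * L := by gcongr
    nlinarith
  have e2 : Λ ≤ 2 * (D * Λ ^ 2 * L) := by
    have : (1 : ℝ) * Λ ^ 2 * (69 / 100) ≤ D * Λ ^ 2 * L := by gcongr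
    nlinarith
  have hδ : Real.exp (-Λ) = δ / 4 := by
    rw [hΛ, Real.exp_neg, Real.exp_log (by positivity), inv_div]
  calc (n : ℝ) ^ (D + 1) * Real.exp (-(k / 12))
      = Real.exp ((D + 1 : ℕ) * L + -(k / 12)) := by
        rw [Real.exp_add, Real.exp_nat_mul, Real.exp_log hpos]
    _ ≤ Real.exp (-Λ) := Real.exp_le_exp.2 (by push_cast; nlinarith)
    _ ≤ δ / 2 := by rw [hδ]; linarith

/-- Failure probability of the noise event: number of ball cuts times Hoeffding bound. -/
theorem pow_mul_two_mul_exp_le (hD : 1 ≤ D) (hδ₀ : 0 < δ) (hδ₁ : δ < 1) (hk : 1 ≤ k)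
    (hn : 3 ≤ n) :
    ((n + 1) ^ (D + 2) : ℕ) * (2 * Real.exp (-(2 * Real.sqrt
      ((2 * Real.log (4 * D / δ) + 2 * D * Real.log n) / k) ^ 2 * k))) ≤ δ / 2 := by
  have hD' : (1 : ℝ) ≤ D := by exact_mod_cast hD
  have hk' : (0 : ℝ) < k := by exact_mod_cast hk
  have hn' : (3 : ℝ) ≤ n := by exact_mod_cast hn
  have hpos : (0 : ℝ) < n := by linarith
  have hratio : 4 / δ ≤ 4 * D / δ := by gcongr; linarith
  have hlog : 0 ≤ Real.log (4 * D / δ) := by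
    have := Real.log_le_log (by positivity) hratio
    linarith [log_four_div_ge hδ₀ hδ₁]
  have hL : 0 ≤ Real.log n := Real.log_nonneg (by linarith)
  rw [Real.sq_sqrt (by positivity)]
  have hexp : Real.exp (-(2 * ((2 * Real.log (4 * D / δ) + 2 * D * Real.log n) / k) * k)) ≤
      δ / 4 * ((n : ℝ) ^ (4 * D))⁻¹ := by
    have hinv : δ / 4 * ((n : ℝ) ^ (4 * D))⁻¹ =
        Real.exp (-Real.log (4 / δ) + -((4 * D : ℕ) * Real.log n)) := by
      rw [Real.exp_add, Real.exp_neg, Real.exp_neg, Real.exp_nat_mul, Real.exp_log (by positivity),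
        Real.exp_log hpos, inv_div]
    rw [hinv]
    refine Real.exp_le_exp.2 ?_
    have : 2 * ((2 * Real.log (4 * D / δ) + 2 * D * Real.log n) / k) * k =
        4 * Real.log (4 * D / δ) + 4 * D * Real.log n := by field_simp; ring
    rw [this]
    push_cast
    have := Real.log_le_log (by positivity) hratio
    linarith
  -- Uses `D + 2 ≤ 3 * D` and `(n + 1) ^ 3 ≤ n ^ 4`, the latter needing `3 ≤ n`.
  have hpow : (((n + 1) ^ (D + 2) : ℕ) : ℝ) ≤ (n : ℝ) ^ (4 * D) := by
    push_cast
    calc ((n : ℝ) + 1) ^ (D + 2) ≤ ((n : ℝ) + 1) ^ (3 * D) :=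
          pow_le_pow_right₀ (by linarith) (by omega)
      _ = (((n : ℝ) + 1) ^ 3) ^ D := pow_mul _ _ _
      _ ≤ ((n : ℝ) ^ 4) ^ D := by
          gcongr
          nlinarith [mul_nonneg (sub_nonneg.2 hn') (sub_nonneg.2 hn'),
            pow_pos hpos 2, pow_pos hpos 3]
      _ = (n : ℝ) ^ (4 * D) := (pow_mul _ _ _).symm
  calc _ ≤ (n : ℝ) ^ (4 * D) * (2 * (δ / 4 * ((n : ℝ) ^ (4 * D))⁻¹)) := by gcongr
    _ = δ / 2 := by field_simp; ring

end Numerics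

/-! ### The finite-sample bound. -/

section FiniteSample

variable {D : ℕ} {S : Set (EuclideanSpace ℝ (Fin D))} {p η : EuclideanSpace ℝ (Fin D) → ℝ}
  {w r₀ α C : ℝ}

open Classical in
/-- Uniformly over the centres in the support, balls of mass at least `2 * k / n` hold at least `k`
sample points with high probability. -/
theorem exists_centres_of_knn (hD : 1 ≤ D) (hw : 0 < w) (h : KNNAssumption S p η w r₀ α C)
    {δ : ℝ} {n k : ℕ} (hδ₀ : 0 < δ) (hδ₁ : δ < 1) (hk : 1 ≤ k)
    (hlow : 2 ^ 8 * (D : ℝ) * Real.log (4 / δ) ^ 2 * Real.log n ≤ k) {r : ℝ} (hr : 0 < r)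
    (hr₀ : r ≤ r₀) (hrD : w * unitBallVolume D * minDensity S p * r ^ D * n = 2 * k) :
    12 * D ≤ n ∧
    (Measure.pi fun _ : Fin n => featureLaw S p)
      {x | ¬ ∀ y ∈ S, k ≤ (Finset.univ.filter fun i => dist y (x i) ≤ r).card} ≤
        ENNReal.ofReal (δ / 2) := by
  have := isProbabilityMeasure_featureLaw h.density
  have hv := unitBallVolume_pos D
  have hp := h.minDensity_pos
  have hD' : (1 : ℝ) ≤ D := by exact_mod_cast hD
  have hk' : (1 : ℝ) ≤ k := by exact_mod_cast hk
  set q := w * unitBallVolume D * minDensity S p with hq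
  have hq0 : 0 < q := by positivity
  have hn0 : (0 : ℝ) < n := by
    by_contra! hcon
    have : (n : ℝ) = 0 := le_antisymm hcon (Nat.cast_nonneg n)
    rw [this] at hrD
    linarith
  -- By Bernoulli, shrinking the radius by this `s` keeps three quarters of `r ^ D`, so the
  -- guaranteed mass drops only from `2 * k / n` to `3 * k / (2 * n)`. It also makes the radius
  -- strictly less than `r₀`, as regularity demands.
  set s := r / (4 * D) with hs
  have hs0 : 0 < s := by positivity
  have hsr : s ≤ r / 4 := by
    rw [hs]; gcongr; linarith
  have hbern : 3 / 4 * r ^ D ≤ (r - s) ^ D := by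
    have h1 : r - s = r * (1 + -(1 / (4 * D))) := by rw [hs]; ring
    have h2 := one_add_mul_le_pow (a := -(1 / (4 * (D : ℝ)))) (by
      have : 1 / (4 * (D : ℝ)) ≤ 1 := by rw [div_le_one (by positivity)]; linarith
      linarith) D
    have h3 : 1 + (D : ℝ) * -(1 / (4 * D)) = 3 / 4 := by field_simp; norm_num
    rw [h1, mul_pow, mul_comm]
    rw [h3] at h2
    gcongr
  have hmass : ∀ c ∈ S, 3 / 2 * (k : ℝ) ≤
      n * (featureLaw S p).real (Metric.closedBall c (r - s)) := fun c hc => by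
    have h1 := h.le_featureLaw_closedBall hD hw hc (r := r - s) (by linarith) (by linarith)
    rw [← hq] at h1
    have h2 : q * (3 / 4 * r ^ D) ≤ q * (r - s) ^ D := by gcongr
    nlinarith
  obtain ⟨y₀, hy₀⟩ : S.Nonempty := by
    rw [Set.nonempty_iff_ne_empty]
    intro hemp
    have := h.density.lintegral_eq_one
    simp [hemp] at this
  have hkn : 3 * k ≤ 2 * n := by
    have h1 := hmass y₀ hy₀
    have h2 : (featureLaw S p).real (Metric.closedBall y₀ (r - s)) ≤ 1 := measureReal_le_one
    have : (3 : ℝ) * k ≤ 2 * n := by nlinarith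
    exact_mod_cast this
  have h12 := twelve_mul_le_of_knn hδ₀ hδ₁ hk hlow hkn
  refine ⟨h12, ?_⟩
  obtain ⟨N, hNS, hNc, hN⟩ := exists_finset_net (μ := featureLaw S p) (S := S) (s := s)
    (q := q * (s / 3) ^ D) hs0 (by positivity) fun x hx =>
      h.le_featureLaw_closedBall hD hw hx (by positivity) (by linarith)
  -- Since `s / 3 = r / (12 * D)`, the net has at most `(12 * D) ^ D * n / (2 * k)` points.
  have hNcard : (N.card : ℝ) ≤ (n : ℝ) ^ (D + 1) := by
    have h1 : q * (s / 3) ^ D * (12 * D) ^ D * n = 2 * k := by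
      have : (s / 3) ^ D * (12 * D) ^ D = r ^ D := by
        rw [← mul_pow, hs]; congr 1; field_simp; norm_num
      rw [mul_assoc q, this, hrD]
    have h2 : ((12 : ℝ) * D) ^ D ≤ (n : ℝ) ^ D := by
      gcongr
      exact_mod_cast h12
    have h3 : (N.card : ℝ) * (2 * k) ≤ (12 * D) ^ D * n := by
      rw [← h1]
      have : (N.card : ℝ) * (q * (s / 3) ^ D) * ((12 * D) ^ D * n) ≤ 1 * ((12 * D) ^ D * n) := by
        gcongr
      linarith
    have h4 : (N.card : ℝ) * 1 ≤ N.card * (2 * k) := by gcongr; linarith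
    calc (N.card : ℝ) ≤ (12 * D) ^ D * n := by linarith
      _ ≤ (n : ℝ) ^ D * n := by gcongr
      _ = (n : ℝ) ^ (D + 1) := (pow_succ _ _).symm
  have hsub : {x : Fin n → EuclideanSpace ℝ (Fin D) |
      ¬ ∀ y ∈ S, k ≤ (Finset.univ.filter fun i => dist y (x i) ≤ r).card} ⊆
      ⋃ c ∈ N, {x | (Finset.univ.filter fun i => x i ∈ Metric.closedBall c (r - s)).card < k} := by
    intro x hx
    simp only [Set.mem_ofPred_eq, not_forall, not_le] at hx
    obtain ⟨y, hy, hlt⟩ := hx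
    obtain ⟨c, hc, hyc⟩ := hN y hy
    refine Set.mem_iUnion₂.2 ⟨c, hc, lt_of_le_of_lt (Finset.card_le_card fun i hi => ?_) hlt⟩
    simp only [Finset.mem_filter, Finset.mem_univ, true_and, Metric.mem_closedBall] at hi ⊢
    have := dist_triangle_right y (x i) c
    linarith
  refine (measure_mono hsub).trans ((measure_biUnion_finset_le _ _).trans ?_)
  refine (Finset.sum_le_card_nsmul _ _ (ENNReal.ofReal (Real.exp (-(k / 12)))) fun c hc =>
    measure_pi_card_lt_le measurableSet_closedBall n k (hmass c (hNS hc))).trans ?_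
  rw [nsmul_eq_mul, ← ENNReal.ofReal_natCast, ← ENNReal.ofReal_mul (Nat.cast_nonneg _)]
  refine ENNReal.ofReal_le_ofReal (le_trans ?_
    (pow_mul_exp_le_of_knn hD hδ₀ hδ₁ (by omega) hlow))
  gcongr

/-- The finite-sample uniform error bound for `k`-NN regression. -/
theorem knnLabel_uniform_bound (hD : 1 ≤ D) (hα₀ : 0 < α) (hC : 0 < C) (hw : 0 < w) (hr₀ : 0 < r₀)
    (h : KNNAssumption S p η w r₀ α C) {δ : ℝ} {n k : ℕ} (hδ₀ : 0 < δ) (hδ₁ : δ < 1) (hk : 1 ≤ k)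
    (hlow : 2 ^ 8 * (D : ℝ) * Real.log (4 / δ) ^ 2 * Real.log n ≤ k)
    (hupp : (k : ℝ) ≤ 1 / 2 * w * minDensity S p * unitBallVolume D * r₀ ^ D * n) :
    WithProbAtLeast (sampleLaw S p η n) (1 - δ)
      {z | ∀ x ∈ S, |knnLabel S z k x - η x| ≤
        C * (2 * k / (w * unitBallVolume D * n * minDensity S p)) ^ (α / (D : ℝ)) +
          Real.sqrt ((2 * Real.log (4 * D / δ) + 2 * D * Real.log n) / k)} := by
  have hS := h.compact.measurableSet
  have := isProbabilityMeasure_featureLaw h.density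
  have hηm := h.label.measurable_indicator hα₀ hS
  have h01 := h.label.indicator_mem_Icc
  have hv := unitBallVolume_pos D
  have hp := h.minDensity_pos
  have hk' : (1 : ℝ) ≤ k := by exact_mod_cast hk
  have hn0 : (0 : ℝ) < n := by
    by_contra! hcon
    have : (n : ℝ) = 0 := le_antisymm hcon (Nat.cast_nonneg n)
    rw [this, mul_zero] at hupp
    linarith
  rw [sampleLaw_congr (η' := S.indicator η) hS fun x hx => (Set.indicator_of_mem hx η).symm]
  have := isProbabilityMeasure_sampleLaw h.density hηm h01 n
  set B := 2 * k / (w * unitBallVolume D * n * minDensity S p) with hB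
  have hB0 : 0 < B := by positivity
  -- The radius whose guaranteed mass is `2 * k / n`; the upper bound on `k` says exactly that `r ≤
  -- r₀`.
  set r := B ^ ((D : ℝ)⁻¹) with hr
  have hrpos : 0 < r := Real.rpow_pos_of_pos hB0 _
  have hrD : r ^ D = B := Real.rpow_inv_natCast_pow hB0.le (by omega)
  have hrα : r ^ α = B ^ (α / (D : ℝ)) := by
    rw [hr, ← Real.rpow_mul hB0.le]; congr 1; rw [inv_mul_eq_div]
  have hrr₀ : r ≤ r₀ := by
    refine le_of_pow_le_pow_left₀ (n := D) (by omega) hr₀.le ?_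
    rw [hrD, hB, div_le_iff₀ (by positivity)]
    linarith
  obtain ⟨h12, hcount⟩ := exists_centres_of_knn hD hw h hδ₀ hδ₁ hk hlow hrpos hrr₀ (by
    rw [hrD, hB]; field_simp)
  set t := Real.sqrt ((2 * Real.log (4 * D / δ) + 2 * D * Real.log n) / k) with ht
  refine withProbAtLeast_of_measure_compl_le hδ₀.le ?_
  set W : Set (Fin n → EuclideanSpace ℝ (Fin D)) :=
    {x | ¬ ∀ y ∈ S, k ≤ (Finset.univ.filter fun i => dist y (x i) ≤ r).card}
  have hsub : {z : Fin n → EuclideanSpace ℝ (Fin D) × ℝ | ∀ x ∈ S, |knnLabel S z k x - η x| ≤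
      C * B ^ (α / (D : ℝ)) + t}ᶜ ⊆
      (fun z i => (z i).1) ⁻¹' ({x | ¬ ∀ i, x i ∈ S} ∪ {x | ¬ Function.Injective x} ∪ W) ∪
        deviationEvent (S.indicator η) n k t := by
    rw [Set.compl_subset_comm]
    intro z hz x hx
    simp only [Set.compl_union, Set.mem_inter_iff, Set.mem_compl_iff, Set.preimage_union,
      Set.mem_preimage, Set.mem_ofPred_eq, not_not, W] at hz
    obtain ⟨⟨⟨hzS, hinj⟩, hW⟩, hdev⟩ := hz
    obtain ⟨I, hcut, hkI, hIr, heq⟩ := exists_ballCut_knnLabel_eq hzS hinj hk (hW x hx)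
    rw [heq]
    refine abs_average_sub_le (by omega) (a := fun i => S.indicator η (z i).1) ?_ fun i hi => ?_
    · by_contra! hcon
      exact hdev (Set.mem_iUnion.2 ⟨I, hcut, hkI, hcon.le⟩)
    · simp only [Set.indicator_of_mem (hzS i)]
      refine (h.label.holder _ (hzS i) x hx).trans ?_
      rw [← hrα]
      gcongr
      exact hIr i hi
  have hX : sampleLaw S p (S.indicator η) n ((fun z i => (z i).1) ⁻¹'
      ({x | ¬ ∀ i, x i ∈ S} ∪ {x | ¬ Function.Injective x} ∪ W)) ≤ ENNReal.ofReal (δ / 2) := by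
    -- An inequality valid for arbitrary sets, because measurability of `W`, defined by a condition
    -- over all centres in `S`, is not established.
    refine (Measure.le_map_apply (show Measurable fun
      (z : Fin n → EuclideanSpace ℝ (Fin D) × ℝ) i => (z i).1 by fun_prop).aemeasurable _).trans ?_
    rw [sampleLaw_map_fst h.density hηm h01]
    refine (measure_union_le _ _).trans ?_
    refine (add_le_add (measure_union_null (ae_iff.1 (ae_mem_pi_featureLaw hS h.density n))
      (ae_iff.1 (ae_injective_pi_featureLaw hD h.density n))).le ?_).trans (zero_add _).le
    convert hcount
  have hdev : sampleLaw S p (S.indicator η) n (deviationEvent (S.indicator η) n k t) ≤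
      ENNReal.ofReal (δ / 2) := by
    refine (sampleLaw_deviationEvent_le h.density hηm h01 n k (Real.sqrt_nonneg _)).trans ?_
    rw [← ENNReal.ofReal_natCast, ← ENNReal.ofReal_mul (Nat.cast_nonneg _)]
    exact ENNReal.ofReal_le_ofReal (pow_mul_two_mul_exp_le hD hδ₀ hδ₁ hk (by omega))
  refine (measure_mono hsub).trans ((measure_union_le _ _).trans ((add_le_add hX hdev).trans ?_))
  rw [← ENNReal.ofReal_add (by linarith) (by linarith), add_halves]

end FiniteSample

/-! ### Balancing bias and noise. -/

section Rate

theorem WithProbAtLeast.mono {Ω : Type*} [MeasurableSpace Ω] {μ : Measure Ω} {q : ℝ} {A A' : Set Ω}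
    (h : WithProbAtLeast μ q A) (hA : A ⊆ A') : WithProbAtLeast μ q A' := by
  obtain ⟨B, hB, hBA, hq⟩ := h
  exact ⟨B, hB, hBA.trans hA, hq⟩

open Filter in
/-- All size requirements of the rate theorem hold for large samples. -/
theorem eventually_rate_conditions {a b c e f β : ℝ} (ha : 0 < a) (hc : 0 < c) (hβ₀ : 0 < β)
    (hβ₁ : β < 1) :
    ∀ᶠ n : ℕ in atTop, 1 ≤ n ∧ 1 ≤ Real.log n ∧ f ≤ Real.log n ∧
      e * Real.log n ≤ a * (n : ℝ) ^ β ∧ b * (n : ℝ) ^ β ≤ c * n := by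
  have hlog : Tendsto (fun n : ℕ => Real.log n) atTop atTop :=
    Real.tendsto_log_atTop.comp tendsto_natCast_atTop_atTop
  have h4 : ∀ᶠ n : ℕ in atTop, e * Real.log n ≤ a * (n : ℝ) ^ β := by
    have h := (((isLittleO_log_rpow_atTop hβ₀).const_mul_left e).bound ha)
    filter_upwards [tendsto_natCast_atTop_atTop.eventually h] with n hn
    rw [Real.norm_eq_abs, Real.norm_of_nonneg (by positivity)] at hn
    exact (le_abs_self _).trans hn
  have h5 : ∀ᶠ n : ℕ in atTop, b / c ≤ (n : ℝ) ^ (1 - β) :=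
    ((tendsto_rpow_atTop (sub_pos.2 hβ₁)).comp
      tendsto_natCast_atTop_atTop).eventually_ge_atTop _
  filter_upwards [eventually_ge_atTop 1, hlog.eventually_ge_atTop 1, hlog.eventually_ge_atTop f,
    h4, h5] with n h1 h2 h3 h4 h5
  refine ⟨h1, h2, h3, h4, ?_⟩
  have hn : (0 : ℝ) < n := by exact_mod_cast h1
  have hsplit : (n : ℝ) = (n : ℝ) ^ (1 - β) * (n : ℝ) ^ β := by
    rw [← Real.rpow_add hn, sub_add_cancel, Real.rpow_one]
  calc b * (n : ℝ) ^ β ≤ (c * (n : ℝ) ^ (1 - β)) * (n : ℝ) ^ β := by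
        gcongr
        rwa [div_le_iff₀' hc] at h5
    _ = c * n := by rw [mul_assoc, ← hsplit]

/-- The finite-sample bound is of the order of the rate when `k` is of the balancing order. -/
theorem uniform_bound_le_rate {D n : ℕ} (hD : 1 ≤ D) {α C K m a b k F : ℝ} (hα₀ : 0 < α)
    (hC : 0 < C) (hK : 0 < K) (hm : K ≤ m) (ha : 0 < a) (hb : 0 < b) (hn : 1 ≤ n)
    (hlog : 1 ≤ Real.log n) (hF : F ≤ Real.log n)
    (hka : a * (n : ℝ) ^ (2 * α / (2 * α + D)) ≤ k)
    (hkb : k ≤ b * (n : ℝ) ^ (2 * α / (2 * α + D))) :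
    C * (2 * k / (m * n)) ^ (α / (D : ℝ)) + Real.sqrt ((2 * F + 2 * D * Real.log n) / k) ≤
      (C * (2 * b / K) ^ (α / (D : ℝ)) + Real.sqrt ((2 + 2 * D) / a)) * Real.sqrt (Real.log n) *
        (n : ℝ) ^ (-(α / (2 * α + D))) := by
  have hD' : (0 : ℝ) < D := by exact_mod_cast hD
  have hn' : (0 : ℝ) < n := by exact_mod_cast hn
  have hden : 0 < 2 * α + D := by positivity
  set β := 2 * α / (2 * α + D) with hβ
  set γ := α / (2 * α + D) with hγ
  have hnβ : (0 : ℝ) < (n : ℝ) ^ β := Real.rpow_pos_of_pos hn' _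
  have hk : 0 < k := lt_of_lt_of_le (by positivity) hka
  -- The bias term has no logarithm; this lets it share the factor of the noise term.
  have hs : 1 ≤ Real.sqrt (Real.log n) := Real.one_le_sqrt.2 hlog
  have h1 : (2 * k / (m * n)) ^ (α / (D : ℝ)) ≤
      (2 * b / K) ^ (α / (D : ℝ)) * (n : ℝ) ^ (-γ) := by
    have e1 : 2 * k / (m * n) ≤ 2 * b / K * (n : ℝ) ^ (β - 1) := by
      rw [Real.rpow_sub_one hn'.ne', div_mul_div_comm]
      have : 2 * k ≤ 2 * b * (n : ℝ) ^ β := by linarith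
      gcongr
    -- The balance: `β - 1 = -D / (2 * α + D)` for the bias, while `γ = β / 2` serves the noise.
    have e2 : (β - 1) * (α / D) = -γ := by
      rw [hβ, hγ]; field_simp; ring
    calc _ ≤ (2 * b / K * (n : ℝ) ^ (β - 1)) ^ (α / (D : ℝ)) := by
          have : 0 < m := hK.trans_le hm
          gcongr
      _ = _ := by rw [Real.mul_rpow (by positivity) (by positivity), ← Real.rpow_mul hn'.le, e2]
  have h2 : Real.sqrt ((2 * F + 2 * D * Real.log n) / k) ≤
      Real.sqrt ((2 + 2 * D) / a) * Real.sqrt (Real.log n) * (n : ℝ) ^ (-γ) := by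
    have e1 : (n : ℝ) ^ (-γ) = Real.sqrt ((n : ℝ) ^ (-β)) := by
      rw [Real.sqrt_eq_rpow, ← Real.rpow_mul hn'.le]
      congr 1
      rw [hβ, hγ]; ring
    rw [e1, ← Real.sqrt_mul (by positivity), ← Real.sqrt_mul (by positivity)]
    refine Real.sqrt_le_sqrt ?_
    rw [Real.rpow_neg hn'.le]
    calc (2 * F + 2 * D * Real.log n) / k ≤ ((2 + 2 * D) * Real.log n) / (a * (n : ℝ) ^ β) := by
          gcongr
          linarith
      _ = _ := by field_simp
  have hP : 0 ≤ C * (2 * b / K) ^ (α / (D : ℝ)) * (n : ℝ) ^ (-γ) := by positivity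
  calc _ ≤ C * ((2 * b / K) ^ (α / (D : ℝ)) * (n : ℝ) ^ (-γ)) +
        Real.sqrt ((2 + 2 * D) / a) * Real.sqrt (Real.log n) * (n : ℝ) ^ (-γ) := by gcongr
    _ ≤ _ := by nlinarith

theorem knnLabel_rate {D : ℕ} (hD : 1 ≤ D) {α C : ℝ} (hα₀ : 0 < α) (hC : 0 < C)
    {w r₀ p₀ a b : ℝ} (hw : 0 < w) (hr₀ : 0 < r₀) (hp₀ : 0 < p₀) (ha : 0 < a) (hb : 0 < b) :
    ∃ A : ℝ, 0 < A ∧ ∀ δ : ℝ, 0 < δ → δ < 1 → ∃ N : ℕ, ∀ n k : ℕ, N ≤ n →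
      a * (n : ℝ) ^ (2 * α / (2 * α + D)) ≤ k → (k : ℝ) ≤ b * (n : ℝ) ^ (2 * α / (2 * α + D)) →
      ∀ (S : Set (EuclideanSpace ℝ (Fin D))) (p η : EuclideanSpace ℝ (Fin D) → ℝ),
        KNNAssumption S p η w r₀ α C → p₀ ≤ minDensity S p →
        WithProbAtLeast (sampleLaw S p η n) (1 - δ)
          {z | ∀ x ∈ S, |knnLabel S z k x - η x| ≤
            A * Real.sqrt (Real.log n) * (n : ℝ) ^ (-(α / (2 * α + D)))} := by
  have hv := unitBallVolume_pos D
  have hD' : (0 : ℝ) < D := by exact_mod_cast hD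
  refine ⟨C * (2 * b / (w * unitBallVolume D * p₀)) ^ (α / (D : ℝ)) + Real.sqrt ((2 + 2 * D) / a),
    by positivity, fun δ hδ₀ hδ₁ => ?_⟩
  obtain ⟨N, hN⟩ := Filter.eventually_atTop.1 (eventually_rate_conditions (a := a) (b := b)
    (c := 1 / 2 * w * p₀ * unitBallVolume D * r₀ ^ D) (f := Real.log (4 * D / δ))
    (e := 2 ^ 8 * (D : ℝ) * Real.log (4 / δ) ^ 2) (β := 2 * α / (2 * α + D)) ha (by positivity)
    (by positivity) (by rw [div_lt_one (by positivity)]; linarith))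
  refine ⟨N, fun n k hn hka hkb S p η h hmin => ?_⟩
  obtain ⟨h1, h2, h3, h4, h5⟩ := hN n hn
  have hn' : (0 : ℝ) < n := by exact_mod_cast h1
  have hk : 0 < (k : ℝ) := lt_of_lt_of_le (by positivity) hka
  refine (knnLabel_uniform_bound hD hα₀ hC hw hr₀ h hδ₀ hδ₁ (by exact_mod_cast hk)
    (h4.trans hka) ((hkb.trans h5).trans (by gcongr))).mono fun z hz x hx => ?_
  refine (hz x hx).trans ?_
  have := uniform_bound_le_rate (n := n) (F := Real.log (4 * D / δ)) hD hα₀ hC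
    (K := w * unitBallVolume D * p₀) (m := w * unitBallVolume D * minDensity S p)
    (by positivity) (by gcongr) ha hb h1 h2 h3 hka hkb
  rwa [mul_right_comm _ (minDensity S p)] at this

end Rate

/-! ### The minimax lower bound by Le Cam's method. -/

section LowerBound

theorem lintegral_pi_prod {Ω : Type*} [MeasurableSpace Ω] {n : ℕ} {μ : Measure Ω}
    [IsProbabilityMeasure μ] {f : Fin n → Ω → ENNReal} (hf : ∀ i, Measurable (f i)) :
    ∫⁻ x, ∏ i, f i (x i) ∂(Measure.pi fun _ : Fin n => μ) = ∏ i, ∫⁻ y, f i y ∂μ := by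
  have hind := ProbabilityTheory.iIndepFun_pi (μ := fun _ : Fin n => μ) (X := f)
    fun i => (hf i).aemeasurable
  rw [ProbabilityTheory.lintegral_prod_eq_prod_lintegral_of_indepFun Finset.univ _ hind
    fun i => (hf i).comp (measurable_pi_apply i)]
  exact Finset.prod_congr rfl fun i _ =>
    (measurePreserving_eval (fun _ : Fin n => μ) i).lintegral_comp (hf i)

/-- The likelihood ratio of an independent sample is the product of the individual ratios; it
suffices to compare on boxes. -/
theorem pi_withDensity {Ω : Type*} [MeasurableSpace Ω] (n : ℕ) {μ : Measure Ω}
    [IsProbabilityMeasure μ] {l : Ω → ENNReal} (hl : Measurable l)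
    [SigmaFinite (μ.withDensity l)] :
    (Measure.pi fun _ : Fin n => μ.withDensity l) =
      (Measure.pi fun _ : Fin n => μ).withDensity fun x => ∏ i, l (x i) := by
  refine Measure.pi_eq fun s hs => ?_
  rw [withDensity_apply _ (MeasurableSet.univ_pi hs),
    ← lintegral_indicator (MeasurableSet.univ_pi hs)]
  have : (Set.univ.pi s).indicator (fun x : Fin n → Ω => ∏ i, l (x i)) =
      fun x => ∏ i, (s i).indicator l (x i) := by
    ext x
    by_cases hx : x ∈ Set.univ.pi s
    · rw [Set.indicator_of_mem hx]
      exact Finset.prod_congr rfl fun i _ => (Set.indicator_of_mem (hx i trivial) _).symm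
    · rw [Set.indicator_of_notMem hx]
      obtain ⟨i, hi⟩ : ∃ i, x i ∉ s i := by simpa [Set.mem_pi] using hx
      exact (Finset.prod_eq_zero (Finset.mem_univ i) (Set.indicator_of_notMem hi _)).symm
  rw [this, lintegral_pi_prod fun i => hl.indicator (hs i)]
  exact Finset.prod_congr rfl fun i _ => by
    rw [lintegral_indicator (hs i), withDensity_apply _ (hs i)]

/-- **Le Cam's two-point argument**: two events covering the whole space cannot both be unlikely,
one under `μ` and one under a measure with square-integrable density. -/
theorem quarter_le_of_lintegral_sq_le {Ω : Type*} [MeasurableSpace Ω] {μ : Measure Ω}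
    {L : Ω → ENNReal} [IsProbabilityMeasure (μ.withDensity L)] (hL : Measurable L)
    (h2 : ∫⁻ x, L x ^ 2 ∂μ ≤ ENNReal.ofReal (9 / 4)) {E₀ E₁ : Set Ω}
    (hE₀ : MeasurableSet E₀) (hcover : E₀ ∪ E₁ = Set.univ) :
    ENNReal.ofReal (1 / 4) ≤ μ E₀ ∨ ENNReal.ofReal (1 / 4) ≤ μ.withDensity L E₁ := by
  by_contra! hcon
  obtain ⟨h0, h1⟩ := hcon
  -- This is `(L x - 3) ^ 2 ≥ 0`, a linearised Cauchy–Schwarz. If `μ E₀ < 1 / 4` it gives `E₀` mass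
  -- below `(9 / 4 + 9 / 4) / 6 = 3 / 4` under the second measure, leaving more than `1 / 4` for
  -- `E₁`.
  have hpoint : ∀ x, 6 * L x ≤ L x ^ 2 + 9 := fun x => by
    by_cases hx : L x = ⊤
    · simp [hx]
    · lift L x to NNReal using hx with a
      have : 6 * a ≤ a ^ 2 + 9 := by
        rw [← NNReal.coe_le_coe]; push_cast; nlinarith [sq_nonneg ((a : ℝ) - 3)]
      exact_mod_cast this
  have hint : 6 * μ.withDensity L E₀ ≤ ENNReal.ofReal (9 / 4) + 9 * μ E₀ := by
    rw [withDensity_apply _ hE₀, ← lintegral_const_mul _ hL]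
    refine (lintegral_mono hpoint).trans ?_
    rw [lintegral_add_right _ measurable_const, setLIntegral_const]
    gcongr
    exact (setLIntegral_le_lintegral _ _).trans h2
  have htot : 1 ≤ μ.withDensity L E₀ + μ.withDensity L E₁ := by
    rw [← measure_univ (μ := μ.withDensity L), ← hcover]
    exact measure_union_le _ _
  have hfin0 : μ E₀ ≠ ⊤ := (h0.trans ENNReal.ofReal_lt_top).ne
  have e0 : (μ E₀).toReal < 1 / 4 := by
    rwa [← ENNReal.lt_ofReal_iff_toReal_lt hfin0]
  have e1 : (μ.withDensity L E₁).toReal < 1 / 4 := by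
    rwa [← ENNReal.lt_ofReal_iff_toReal_lt (measure_ne_top _ _)]
  have e2 := ENNReal.toReal_mono (by finiteness) hint
  have e3 := ENNReal.toReal_mono (by finiteness) htot
  rw [ENNReal.toReal_add (by finiteness) (by finiteness)] at e2 e3
  simp only [ENNReal.toReal_mul, ENNReal.toReal_ofNat, ENNReal.toReal_one] at e2 e3
  rw [ENNReal.toReal_ofReal (by norm_num)] at e2
  linarith

variable {D : ℕ} {S : Set (EuclideanSpace ℝ (Fin D))} {p η : EuclideanSpace ℝ (Fin D) → ℝ}

theorem lintegral_dataLaw (hη : Measurable η) {f : EuclideanSpace ℝ (Fin D) × ℝ → ENNReal}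
    (hf : Measurable f) :
    ∫⁻ z, f z ∂(dataLaw S p η) = ∫⁻ x, ENNReal.ofReal (η x) * f (x, 1) +
      ENNReal.ofReal (1 - η x) * f (x, 0) ∂(featureLaw S p) := by
  have hc : ∀ c : ℝ, Measurable fun x : EuclideanSpace ℝ (Fin D) => (x, c) := fun c => by fun_prop
  have hfc : ∀ c : ℝ, Measurable fun x : EuclideanSpace ℝ (Fin D) => f (x, c) :=
    fun c => hf.comp (hc c)
  rw [dataLaw, lintegral_add_measure, lintegral_map hf (hc 1), lintegral_map hf (hc 0),
    lintegral_withDensity_eq_lintegral_mul _ (by fun_prop) (hfc 1),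
    lintegral_withDensity_eq_lintegral_mul _ (by fun_prop) (hfc 0), ← lintegral_add_left]
  · rfl
  · exact Measurable.mul (by fun_prop) (hfc 1)

/-- The likelihood ratio of a labelled data point when the label probability is `1 / 2 + b x`
instead of `1 / 2`. -/
noncomputable def labelLikelihood (b : EuclideanSpace ℝ (Fin D) → ℝ)
    (z : EuclideanSpace ℝ (Fin D) × ℝ) : ENNReal :=
  ENNReal.ofReal (1 + 2 * b z.1 * (2 * z.2 - 1))

theorem measurable_labelLikelihood {b : EuclideanSpace ℝ (Fin D) → ℝ} (hb : Measurable b) :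
    Measurable (labelLikelihood b) := by
  unfold labelLikelihood
  have : Measurable fun z : EuclideanSpace ℝ (Fin D) × ℝ => b z.1 := hb.comp measurable_fst
  fun_prop

theorem dataLaw_half_add_eq_withDensity {b : EuclideanSpace ℝ (Fin D) → ℝ} (hb : Measurable b) :
    dataLaw S p (fun x => 1 / 2 + b x) =
      (dataLaw S p fun _ => 1 / 2).withDensity (labelLikelihood b) := by
  ext s hs
  rw [withDensity_apply _ hs, ← lintegral_indicator hs, lintegral_dataLaw measurable_const
    ((measurable_labelLikelihood hb).indicator hs), ← lintegral_indicator_one hs,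
    lintegral_dataLaw (hb.const_add _) (measurable_one.indicator hs)]
  refine lintegral_congr fun x => ?_
  congr 1
  · by_cases h : (x, (1 : ℝ)) ∈ s
    · simp only [Set.indicator_of_mem h, Pi.one_apply, mul_one, labelLikelihood]
      rw [← ENNReal.ofReal_mul (by norm_num)]
      congr 1; ring
    · simp [Set.indicator_of_notMem h]
  · by_cases h : (x, (0 : ℝ)) ∈ s
    · simp only [Set.indicator_of_mem h, Pi.one_apply, mul_one, labelLikelihood]
      rw [← ENNReal.ofReal_mul (by norm_num)]
      congr 1; ring
    · simp [Set.indicator_of_notMem h]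

/-- Averaging `(1 + 2 * b x) ^ 2` and `(1 - 2 * b x) ^ 2` cancels the linear term and leaves `1 + 4
* b x ^ 2`. -/
theorem lintegral_labelLikelihood_sq_le (hp : IsDensityOn S p)
    {b : EuclideanSpace ℝ (Fin D) → ℝ} (hb : Measurable b) (hb0 : ∀ x, 0 ≤ b x)
    (hb1 : ∀ x, b x ≤ 1 / 2) {B : Set (EuclideanSpace ℝ (Fin D))} (hB : MeasurableSet B) {τ : ℝ}
    (hτ : ∀ x ∈ B, b x ^ 2 ≤ τ) (hout : ∀ x ∉ B, b x = 0) :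
    ∫⁻ z, labelLikelihood b z ^ 2 ∂(dataLaw S p fun _ => 1 / 2) ≤
      1 + ENNReal.ofReal (4 * τ) * featureLaw S p B := by
  have := isProbabilityMeasure_featureLaw hp
  rw [lintegral_dataLaw measurable_const ((measurable_labelLikelihood hb).pow_const 2)]
  calc _ ≤ ∫⁻ x, 1 + B.indicator (fun _ => ENNReal.ofReal (4 * τ)) x ∂(featureLaw S p) := by
        refine lintegral_mono fun x => ?_
        have e1 : ENNReal.ofReal (1 / 2) * labelLikelihood b (x, 1) ^ 2 +
            ENNReal.ofReal (1 - 1 / 2) * labelLikelihood b (x, 0) ^ 2 =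
            ENNReal.ofReal (1 + 4 * b x ^ 2) := by
          have h0 := hb0 x
          have h1 := hb1 x
          simp only [labelLikelihood]
          rw [← ENNReal.ofReal_pow (by linarith), ← ENNReal.ofReal_pow (by linarith),
            ← ENNReal.ofReal_mul (by norm_num), ← ENNReal.ofReal_mul (by norm_num),
            ← ENNReal.ofReal_add (by positivity) (by positivity)]
          congr 1; ring
        rw [e1, ENNReal.ofReal_add (by norm_num) (by positivity), ENNReal.ofReal_one]
        gcongr
        by_cases hx : x ∈ B
        · rw [Set.indicator_of_mem hx]
          exact ENNReal.ofReal_le_ofReal (by linarith [hτ x hx])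
        · simp [hout x hx]
    _ = _ := by
        rw [lintegral_add_left measurable_const, lintegral_indicator hB]
        simp

/-- Some point of the support has balls of mass at most of the order of their volume. -/
theorem exists_featureLaw_closedBall_le (hD : 1 ≤ D) (hp : IsDensityOn S p) :
    ∃ x₀ ∈ S, ∃ M : ℝ, 0 < M ∧ ∀ h : ℝ, 0 < h →
      (featureLaw S p).real (Metric.closedBall x₀ h) ≤ M * h ^ D := by
  have := isProbabilityMeasure_featureLaw hp
  have hvol : volume S ≠ 0 := by
    intro h0
    have h1 := hp.lintegral_eq_one
    rw [Measure.restrict_eq_zero.2 h0] at h1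
    simp at h1
  obtain ⟨x₀, hx₀, hlim, hfin⟩ : ∃ x₀ ∈ S, Filter.Tendsto (fun r => featureLaw S p
      (Metric.closedBall x₀ r) / volume (Metric.closedBall x₀ r)) (nhdsWithin 0 (Set.Ioi 0))
      (nhds ((featureLaw S p).rnDeriv volume x₀)) ∧ (featureLaw S p).rnDeriv volume x₀ < ⊤ := by
    by_contra! hcon
    -- Lebesgue differentiation holds almost everywhere and `S` has positive volume, so some point
    -- of `S` is good.
    have hae := (Besicovitch.ae_tendsto_rnDeriv (featureLaw S p) volume).and
      ((featureLaw S p).rnDeriv_lt_top volume)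
    refine hvol (measure_mono_null (fun x hx => ?_) (ae_iff.1 hae))
    exact fun h => (hcon x hx h.1).not_gt h.2
  have hv := unitBallVolume_pos D
  set R := (featureLaw S p).rnDeriv volume x₀
  obtain ⟨h₁, hh₁, hball⟩ : ∃ h₁ > 0, ∀ h, 0 < h → h < h₁ → featureLaw S p
      (Metric.closedBall x₀ h) / volume (Metric.closedBall x₀ h) < R + 1 := by
    have hev := hlim.eventually_lt_const (ENNReal.lt_add_right hfin.ne one_ne_zero)
    obtain ⟨h₁, hh₁, hsub⟩ := mem_nhdsGT_iff_exists_Ioo_subset.1 hev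
    exact ⟨h₁, hh₁, fun h h0 h1 => hsub ⟨h0, h1⟩⟩
  -- The first summand handles radii below `h₁`; the second makes the bound at least `1` for larger
  -- ones.
  refine ⟨x₀, hx₀, (R.toReal + 1) * unitBallVolume D + 1 / h₁ ^ D, by positivity,
    fun h hh => ?_⟩
  rcases lt_or_ge h h₁ with hlt | hge
  · have h1 : featureLaw S p (Metric.closedBall x₀ h) ≤
        (R + 1) * volume (Metric.closedBall x₀ h) := by
      refine (ENNReal.div_le_iff_le_mul ?_ ?_).1 (hball h hh hlt).le
      · exact Or.inl (Metric.measure_closedBall_pos _ _ hh).ne'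
      · exact Or.inl measure_closedBall_lt_top.ne
    have h2 := ENNReal.toReal_mono (by
      have := measure_closedBall_lt_top (μ := (volume : Measure (EuclideanSpace ℝ (Fin D))))
        (x := x₀) (r := h)
      finiteness) h1
    rw [ENNReal.toReal_mul, ENNReal.toReal_add hfin.ne ENNReal.one_ne_top,
      volume_closedBall_eq hD x₀ hh.le, ENNReal.toReal_ofReal (by positivity),
      ENNReal.toReal_one] at h2
    refine h2.trans ?_
    have : 0 ≤ 1 / h₁ ^ D * h ^ D := by positivity
    linarith
  · have h1 : (featureLaw S p).real (Metric.closedBall x₀ h) ≤ 1 := measureReal_le_one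
    have h2 : 1 ≤ 1 / h₁ ^ D * h ^ D := by
      rw [one_div_mul_eq_div, one_le_div (by positivity)]
      gcongr
    have h3 : 0 ≤ (R.toReal + 1) * unitBallVolume D * h ^ D := by positivity
    linarith

/-- Subadditivity of `t ↦ t ^ α` for `α ≤ 1`; it makes the bump Hölder. -/
theorem abs_rpow_sub_rpow_le {a b α : ℝ} (ha : 0 ≤ a) (hb : 0 ≤ b) (hα₀ : 0 ≤ α) (hα₁ : α ≤ 1) :
    |a ^ α - b ^ α| ≤ |a - b| ^ α := by
  wlog hab : b ≤ a generalizing a b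
  · rw [abs_sub_comm, abs_sub_comm a]
    exact this hb ha (le_of_not_ge hab)
  rw [abs_of_nonneg (sub_nonneg.2 (Real.rpow_le_rpow hb hab hα₀)), abs_of_nonneg (by linarith)]
  have := Real.rpow_add_le_add_rpow (sub_nonneg.2 hab) hb hα₀ hα₁
  rw [sub_add_cancel] at this
  linarith

/-- A Hölder bump of height `K * h ^ α` and radius `h` around `x₀`. -/
noncomputable def holderBump (x₀ : EuclideanSpace ℝ (Fin D)) (K h α : ℝ)
    (x : EuclideanSpace ℝ (Fin D)) : ℝ :=
  K * max 0 (h ^ α - dist x x₀ ^ α)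

section Bump

variable {x₀ : EuclideanSpace ℝ (Fin D)} {K h α : ℝ}

theorem measurable_holderBump : Measurable (holderBump x₀ K h α) := by
  unfold holderBump
  fun_prop

theorem holderBump_nonneg (hK : 0 ≤ K) (x : EuclideanSpace ℝ (Fin D)) :
    0 ≤ holderBump x₀ K h α x := mul_nonneg hK (le_max_left _ _)

theorem holderBump_le (hK : 0 ≤ K) (hh : 0 ≤ h) (x : EuclideanSpace ℝ (Fin D)) :
    holderBump x₀ K h α x ≤ K * h ^ α := by
  refine mul_le_mul_of_nonneg_left (max_le (Real.rpow_nonneg hh _) ?_) hK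
  linarith [Real.rpow_nonneg (dist_nonneg (x := x) (y := x₀)) α]

theorem holderBump_self (hh : 0 ≤ h) (hα : 0 < α) : holderBump x₀ K h α x₀ = K * h ^ α := by
  rw [holderBump, dist_self, Real.zero_rpow hα.ne', sub_zero, max_eq_right (Real.rpow_nonneg hh _)]

theorem holderBump_eq_zero (hh : 0 ≤ h) (hα : 0 ≤ α) {x : EuclideanSpace ℝ (Fin D)}
    (hx : x ∉ Metric.closedBall x₀ h) : holderBump x₀ K h α x = 0 := by
  rw [Metric.mem_closedBall, not_le] at hx
  rw [holderBump, max_eq_left, mul_zero]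
  linarith [Real.rpow_le_rpow hh hx.le hα]

theorem abs_holderBump_sub_le (hK : 0 ≤ K) (hα₀ : 0 ≤ α) (hα₁ : α ≤ 1)
    (x x' : EuclideanSpace ℝ (Fin D)) :
    |holderBump x₀ K h α x - holderBump x₀ K h α x'| ≤ K * dist x x' ^ α := by
  rw [holderBump, holderBump, ← mul_sub, abs_mul, abs_of_nonneg hK]
  refine mul_le_mul_of_nonneg_left ?_ hK
  have h1 := abs_max_sub_max_le_max 0 (h ^ α - dist x x₀ ^ α) 0 (h ^ α - dist x' x₀ ^ α)
  rw [sub_self, abs_zero, max_eq_right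
    (abs_nonneg (h ^ α - dist x x₀ ^ α - (h ^ α - dist x' x₀ ^ α)))] at h1
  refine h1.trans ?_
  rw [sub_sub_sub_cancel_left, abs_sub_comm]
  refine (abs_rpow_sub_rpow_le dist_nonneg dist_nonneg hα₀ hα₁).trans ?_
  exact Real.rpow_le_rpow (abs_nonneg _) (abs_dist_sub_le x x' x₀) hα₀

end Bump

/-- Two label functions whose samples of size `n` cannot be told apart reliably, and which differ
by the order of the minimax rate at a point. -/
theorem exists_indistinguishable_labels (hD : 1 ≤ D) (hp : IsDensityOn S p) {α C : ℝ}
    (hα₀ : 0 < α) (hα₁ : α ≤ 1) (hC : 0 < C) {x₀ : EuclideanSpace ℝ (Fin D)} {M : ℝ} (hM : 0 < M)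
    (hball : ∀ h : ℝ, 0 < h → (featureLaw S p).real (Metric.closedBall x₀ h) ≤ M * h ^ D) :
    ∃ c : ℝ, 0 < c ∧ ∀ n : ℕ, 1 ≤ n → ∃ b : EuclideanSpace ℝ (Fin D) → ℝ, Measurable b ∧
      (∀ x, 0 ≤ b x) ∧ (∀ x, b x ≤ 1 / 2) ∧ (∀ x x', |b x - b x'| ≤ C * dist x x' ^ α) ∧
      b x₀ = 2 * (c * (n : ℝ) ^ (-(α / (2 * α + D)))) ∧
      (∫⁻ z, labelLikelihood b z ^ 2 ∂(dataLaw S p fun _ => 1 / 2)) ^ n ≤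
        ENNReal.ofReal (9 / 4) := by
  have := isProbabilityMeasure_featureLaw hp
  have hD' : (0 : ℝ) < D := by exact_mod_cast hD
  have hden : 0 < 2 * α + D := by positivity
  set K := min C (1 / 2) with hK
  have hK0 : 0 < K := lt_min hC (by norm_num)
  have hK1 : K ≤ 1 / 2 := min_le_right _ _
  -- Chosen so that `4 * M * h ^ (2 * α + D) ≤ 1 / (2 * n)`; the second moment over `n` observations
  -- is then at most `exp (1 / 2) ≤ 9 / 4`.
  set κ := min 1 ((1 / (8 * M)) ^ ((2 * α + D)⁻¹)) with hκ
  have hκ0 : 0 < κ := lt_min one_pos (Real.rpow_pos_of_pos (by positivity) _)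
  have hκM : κ ^ (2 * α + D) ≤ 1 / (8 * M) := by
    calc κ ^ (2 * α + D) ≤ ((1 / (8 * M)) ^ ((2 * α + D)⁻¹)) ^ (2 * α + D) :=
          Real.rpow_le_rpow hκ0.le (min_le_right _ _) hden.le
      _ = _ := Real.rpow_inv_rpow (by positivity) hden.ne'
  -- Half the bump height: no estimate can be closer than this to both labels at `x₀`.
  refine ⟨K * κ ^ α / 2, by positivity, fun n hn => ?_⟩
  have hn' : (1 : ℝ) ≤ n := by exact_mod_cast hn
  have hn0 : (0 : ℝ) < n := by linarith
  set h := κ * (n : ℝ) ^ (-(2 * α + D)⁻¹) with hh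
  have hh0 : 0 < h := by positivity
  have hnle : (n : ℝ) ^ (-(2 * α + D)⁻¹) ≤ 1 :=
    Real.rpow_le_one_of_one_le_of_nonpos hn' (by simpa using hden.le)
  have hh1 : h ≤ 1 := mul_le_one₀ (min_le_left _ _) (by positivity) hnle
  have hhα : h ^ α = κ ^ α * (n : ℝ) ^ (-(α / (2 * α + D))) := by
    rw [hh, Real.mul_rpow hκ0.le (by positivity), ← Real.rpow_mul hn0.le]
    congr 2; field_simp
  have hhden : h ^ (2 * α + D) ≤ 1 / (8 * M) * (n : ℝ)⁻¹ := by
    rw [hh, Real.mul_rpow hκ0.le (by positivity), ← Real.rpow_mul hn0.le, neg_mul,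
      inv_mul_cancel₀ hden.ne', Real.rpow_neg_one]
    gcongr
  have hKh : K * h ^ α ≤ 1 / 2 := by
    have : h ^ α ≤ 1 := Real.rpow_le_one hh0.le hh1 hα₀.le
    nlinarith [Real.rpow_nonneg hh0.le α]
  refine ⟨holderBump x₀ K h α, measurable_holderBump, holderBump_nonneg hK0.le,
    fun x => (holderBump_le hK0.le hh0.le x).trans hKh, fun x x' => ?_, ?_, ?_⟩
  · refine (abs_holderBump_sub_le hK0.le hα₀.le hα₁ x x').trans ?_
    gcongr
    exact min_le_left _ _
  · rw [holderBump_self hh0.le hα₀, hhα]; ring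
  · have h1 := lintegral_labelLikelihood_sq_le hp measurable_holderBump
      (holderBump_nonneg (x₀ := x₀) (h := h) (α := α) hK0.le)
      (fun x => (holderBump_le hK0.le hh0.le x).trans hKh)
      (measurableSet_closedBall (x := x₀) (ε := h)) (τ := (h ^ α) ^ 2) (fun x _ => by
        refine pow_le_pow_left₀ (holderBump_nonneg hK0.le x) ?_ 2
        refine (holderBump_le hK0.le hh0.le x).trans ?_
        nlinarith [Real.rpow_nonneg hh0.le α])
      (fun x hx => holderBump_eq_zero hh0.le hα₀.le hx)
    have h2 : 1 + ENNReal.ofReal (4 * (h ^ α) ^ 2) * featureLaw S p (Metric.closedBall x₀ h) ≤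
        ENNReal.ofReal (1 + 1 / 2 * (n : ℝ)⁻¹) := by
      rw [ENNReal.ofReal_add (by norm_num) (by positivity), ENNReal.ofReal_one]
      gcongr
      rw [← ENNReal.ofReal_toReal (measure_ne_top (featureLaw S p) (Metric.closedBall x₀ h)),
        ← ENNReal.ofReal_mul (by positivity)]
      refine ENNReal.ofReal_le_ofReal ?_
      calc 4 * (h ^ α) ^ 2 * (featureLaw S p (Metric.closedBall x₀ h)).toReal
          ≤ 4 * (h ^ α) ^ 2 * (M * h ^ D) := by
            gcongr
            exact hball h hh0
        _ = 4 * M * h ^ (2 * α + D) := by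
            rw [Real.rpow_add hh0, Real.rpow_natCast, mul_comm 2 α, Real.rpow_mul hh0.le,
              Real.rpow_two]
            ring
        _ ≤ 4 * M * (1 / (8 * M) * (n : ℝ)⁻¹) := by gcongr
        _ = _ := by field_simp; norm_num
    refine (pow_le_pow_left' (h1.trans h2) n).trans ?_
    rw [← ENNReal.ofReal_pow (by positivity)]
    refine ENNReal.ofReal_le_ofReal ?_
    have h3 : (1 + 1 / 2 * (n : ℝ)⁻¹) ^ n ≤ Real.exp (1 / 2) := by
      have h4 := Real.add_one_le_exp (1 / 2 * (n : ℝ)⁻¹)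
      calc (1 + 1 / 2 * (n : ℝ)⁻¹) ^ n ≤ Real.exp (1 / 2 * (n : ℝ)⁻¹) ^ n := by
            gcongr; linarith
        _ = Real.exp (1 / 2) := by
            rw [← Real.exp_nat_mul]; congr 1; field_simp
    refine h3.trans ?_
    refine le_of_pow_le_pow_left₀ (n := 2) (by norm_num) (by norm_num) ?_
    rw [← Real.exp_nat_mul]
    norm_num
    linarith [Real.exp_one_lt_d9]

theorem sampleLaw_half_add_eq_withDensity (hp : IsDensityOn S p)
    {b : EuclideanSpace ℝ (Fin D) → ℝ} (hb : Measurable b)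
    (h01 : ∀ x, 1 / 2 + b x ∈ Set.Icc (0 : ℝ) 1) (n : ℕ) :
    sampleLaw S p (fun x => 1 / 2 + b x) n =
      (sampleLaw S p (fun _ => 1 / 2) n).withDensity fun z => ∏ i, labelLikelihood b (z i) := by
  have := isProbabilityMeasure_dataLaw (S := S) hp (η := fun _ => 1 / 2) measurable_const
    fun _ => by norm_num
  have hprob := isProbabilityMeasure_dataLaw (S := S) hp (hb.const_add _) h01
  have heq := dataLaw_half_add_eq_withDensity (S := S) (p := p) hb
  rw [heq] at hprob
  simp only [sampleLaw, heq]
  exact pi_withDensity n (measurable_labelLikelihood hb)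

/-- No estimator beats the minimax rate. -/
theorem minimax_lower_bound (hD : 1 ≤ D) {α C : ℝ} (hα₀ : 0 < α) (hα₁ : α ≤ 1) (hC : 0 < C)
    (hp : IsDensityOn S p) :
    ∃ c : ℝ, 0 < c ∧ ∀ n : ℕ, 1 ≤ n →
      ∀ T : (Fin n → EuclideanSpace ℝ (Fin D) × ℝ) → EuclideanSpace ℝ (Fin D) → ℝ,
        (∀ x ∈ S, Measurable fun z => T z x) →
        ∃ η : EuclideanSpace ℝ (Fin D) → ℝ, IsHolderLabel S η α C ∧
          WithProbAtLeast (sampleLaw S p η n) (1 / 4)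
            {z | ∃ x ∈ S, c * (n : ℝ) ^ (-(α / (2 * α + D))) ≤ |T z x - η x|} := by
  obtain ⟨x₀, hx₀, M, hM, hball⟩ := exists_featureLaw_closedBall_le hD hp
  obtain ⟨c, hc, hlab⟩ := exists_indistinguishable_labels hD hp hα₀ hα₁ hC hM hball
  refine ⟨c, hc, fun n hn T hT => ?_⟩
  obtain ⟨b, hb, hb0, hb1, hbC, hbx, hL2⟩ := hlab n hn
  set s := c * (n : ℝ) ^ (-(α / (2 * α + D)))
  have hprob₀ := isProbabilityMeasure_dataLaw (S := S) hp (η := fun _ => 1 / 2) measurable_const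
    fun _ => by norm_num
  have h01 : ∀ x, 1 / 2 + b x ∈ Set.Icc (0 : ℝ) 1 := fun x =>
    ⟨by linarith [hb0 x], by linarith [hb1 x]⟩
  have hprob₁ := isProbabilityMeasure_sampleLaw (S := S) hp (hb.const_add _) h01 n
  have hl := measurable_labelLikelihood hb
  have hdens := sampleLaw_half_add_eq_withDensity (S := S) hp hb h01 n
  have hE : ∀ a : ℝ, MeasurableSet {z | s ≤ |T z x₀ - a|} := fun a =>
    measurableSet_le measurable_const ((hT x₀ hx₀).sub_const a).abs
  rw [hdens] at hprob₁
  -- Triangle inequality, as the two labels differ by `2 * s` at `x₀`.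
  have hcover : {z | s ≤ |T z x₀ - 1 / 2|} ∪ {z | s ≤ |T z x₀ - (1 / 2 + b x₀)|} = Set.univ := by
    refine Set.eq_univ_of_forall fun z => ?_
    by_contra hcon
    simp only [Set.mem_union, Set.mem_ofPred_eq, not_or, not_le, abs_lt] at hcon
    linarith [hcon.1.2, hcon.2.1]
  have hsq : ∫⁻ z, (∏ i, labelLikelihood b (z i)) ^ 2 ∂(sampleLaw S p (fun _ => 1 / 2) n) ≤
      ENNReal.ofReal (9 / 4) := by
    simp only [← Finset.prod_pow]
    rw [sampleLaw, lintegral_pi_prod (f := fun _ z => labelLikelihood b z ^ 2)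
      fun _ => hl.pow_const 2]
    simpa using hL2
  have hmeas : Measurable fun z : Fin n → EuclideanSpace ℝ (Fin D) × ℝ =>
      ∏ i, labelLikelihood b (z i) :=
    Finset.measurable_prod _ fun i _ => hl.comp (measurable_pi_apply i)
  have hevent : ∀ η : EuclideanSpace ℝ (Fin D) → ℝ,
      ENNReal.ofReal (1 / 4) ≤ sampleLaw S p η n {z | s ≤ |T z x₀ - η x₀|} →
      WithProbAtLeast (sampleLaw S p η n) (1 / 4) {z | ∃ x ∈ S, s ≤ |T z x - η x|} :=
    fun η h => ⟨_, hE (η x₀), fun z hz => ⟨x₀, hx₀, hz⟩, h⟩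
  rcases quarter_le_of_lintegral_sq_le hmeas hsq (hE (1 / 2)) hcover with h | h
  · refine ⟨fun _ => 1 / 2, ⟨fun x _ => by norm_num, fun x _ x' _ => ?_⟩, hevent _ h⟩
    rw [sub_self, abs_zero]
    positivity
  · rw [← hdens] at h
    refine ⟨fun x => 1 / 2 + b x, ⟨fun x _ => h01 x, fun x _ x' _ => ?_⟩, hevent _ h⟩
    rw [add_sub_add_left_eq_sub]
    exact hbC x x'

end LowerBound

theorem theorem1 {D : ℕ} (hD : 1 ≤ D) {α C : ℝ} (hα₀ : 0 < α) (hα₁ : α ≤ 1) (hC : 0 < C) :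
    -- the finite-sample uniform bound
    (∀ (S : Set (EuclideanSpace ℝ (Fin D))) (p η : EuclideanSpace ℝ (Fin D) → ℝ) (w r₀ : ℝ),
      0 < w → 0 < r₀ → KNNAssumption S p η w r₀ α C →
      ∀ (δ : ℝ) (n k : ℕ), 0 < δ → δ < 1 → 1 ≤ k →
        2 ^ 8 * (D : ℝ) * Real.log (4 / δ) ^ 2 * Real.log n ≤ k →
        (k : ℝ) ≤ 1 / 2 * w * minDensity S p * unitBallVolume D * r₀ ^ D * n →
        WithProbAtLeast (sampleLaw S p η n) (1 - δ)
          {z | ∀ x ∈ S, |knnLabel S z k x - η x| ≤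
            C * (2 * k / (w * unitBallVolume D * n * minDensity S p)) ^ (α / (D : ℝ)) +
              Real.sqrt ((2 * Real.log (4 * D / δ) + 2 * D * Real.log n) / k)}) ∧
    -- the rate for `k` of order `n ^ (2 * α / (2 * α + D))`
    (∀ w r₀ p₀ a b : ℝ, 0 < w → 0 < r₀ → 0 < p₀ → 0 < a → 0 < b →
      ∃ A : ℝ, 0 < A ∧ ∀ δ : ℝ, 0 < δ → δ < 1 → ∃ N : ℕ, ∀ n k : ℕ, N ≤ n →
        a * (n : ℝ) ^ (2 * α / (2 * α + D)) ≤ k → (k : ℝ) ≤ b * (n : ℝ) ^ (2 * α / (2 * α + D)) →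
        ∀ (S : Set (EuclideanSpace ℝ (Fin D))) (p η : EuclideanSpace ℝ (Fin D) → ℝ),
          KNNAssumption S p η w r₀ α C → p₀ ≤ minDensity S p →
          WithProbAtLeast (sampleLaw S p η n) (1 - δ)
            {z | ∀ x ∈ S, |knnLabel S z k x - η x| ≤
              A * Real.sqrt (Real.log n) * (n : ℝ) ^ (-(α / (2 * α + D)))}) ∧
    -- minimax optimality of this rate: no estimator does better by more than constants and logs
    (∀ (S : Set (EuclideanSpace ℝ (Fin D))) (p : EuclideanSpace ℝ (Fin D) → ℝ),
      IsCompact S → IsDensityOn S p →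
      ∃ c : ℝ, 0 < c ∧ ∀ n : ℕ, 1 ≤ n →
        ∀ T : (Fin n → EuclideanSpace ℝ (Fin D) × ℝ) → EuclideanSpace ℝ (Fin D) → ℝ,
          (∀ x ∈ S, Measurable fun z => T z x) →
          ∃ η : EuclideanSpace ℝ (Fin D) → ℝ, IsHolderLabel S η α C ∧
            WithProbAtLeast (sampleLaw S p η n) (1 / 4)
              {z | ∃ x ∈ S, c * (n : ℝ) ^ (-(α / (2 * α + D))) ≤ |T z x - η x|}) := by
  refine ⟨fun S p η w r₀ hw hr₀ h δ n k hδ₀ hδ₁ hk hlow hupp =>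
      knnLabel_uniform_bound hD hα₀ hC hw hr₀ h hδ₀ hδ₁ hk hlow hupp,
    fun w r₀ p₀ a b hw hr₀ hp₀ ha hb => knnLabel_rate hD hα₀ hC hw hr₀ hp₀ ha hb,
    fun S p _ hp => minimax_lower_bound hD hα₀ hα₁ hC hp⟩
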